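/- Let $k$ be a commutative ring and $A$ an associative unital $k$-algebra. Write $A^e = A\otimes_k A^{op}$, regard $A$ as a left $A^e$-module by $(a\otimes b)x = axb$, and regard $\mathrm{Hom}_k(A,k)$ as a right $A^e$-module by $(f\cdot(a\otimes b))(x) = f(axb)$. Let $\mathscr M_k$ be the bicategory of $k$-algebras, bimodules (with the two actions of $k$ equal) and bimodule maps, in which a 1-cell from $R$ to $S$ is an $(R,S)$-bimodule and the composite of $M\colon R\to S$ and $N\colon S\to T$ is $M\otimes_S N$. A 1-cell $X\colon R\to S$ is invertible if there are a 1-cell $Y\colon S\to R$ and isomorphisms of bimodules $\eta\colon R\to X\otimes_S Y$ and $\varepsilon\colon Y\otimes_R X\to S$ that satisfy the two triangle identities of a dual pair; $R$ is Eilenberg–Watts equivalent to $S$ if there is an invertible 1-cell from $R$ to $S$. The algebra $A$ is called - *central* over $k$ if the structure map is an isomorphism from $k$ onto the center of $A$; - *separable* over $k$ if $A$ is projective as an $A^e$-module; - *faithfully projective* over $k$ if both the coevaluation $\mathrm{Hom}_k(A,k)\otimes_k A\to \mathrm{Hom}_k(A,A)$, $f\otimes a\mapsto (x\mapsto f(x)a)$,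 and the evaluation $\mathrm{Hom}_k(A,k)\otimes_{A^e}A\to k$, $f\otimes x\mapsto f(x)$, are isomorphisms. **Theorem.** The following are equivalent: 1. $A$ is invertible as an $(A^e,k)$-bimodule. 2. $A$ is central and separable over $k$. 3. $A$ is faithfully projective over $k$ and the sandwich map $A^e\to\mathrm{Hom}_k(A,A)$, $a\otimes b\mapsto (x\mapsto axb)$, is an isomorphism. 4. There is a $k$-algebra $B$ such that $A\otimes_k B$ is Eilenberg–Watts equivalent to $k$. Moreover, if 1 holds, then $A^e$ is Eilenberg–Watts equivalent to $k$. -/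

import Mathlib

open scoped TensorProduct MulOpposite

universe u

/-! ### Algebras, bimodules and bimodule maps over a commutative ring -/

/-- A (not necessarily commutative) `k`-algebra, as an object of the bicategory below. -/
structure AlgCell (k : Type u) [CommRing k] : Type (u + 1) where
  /-- The underlying type. -/
  carrier : Type u
  [ring : Ring carrier]
  [algebra : Algebra k carrier]

namespace AlgCell

attribute [instance] AlgCell.ring AlgCell.algebra

/-- The `k`-algebra `A` as a 0-cell. -/
abbrev of (k : Type u) [CommRing k] (A : Type u) [Ring A] [Algebra k A] : AlgCell k := ⟨A⟩

end AlgCell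

/-- A bimodule over the `k`-algebras `A` (acting on the left) and `B` (acting on the right),
on which the two induced actions of `k` coincide: a `k`-module with commuting `k`-algebra
homomorphisms `A → End_k(M)` and `Bᵒᵖ → End_k(M)`. -/
structure BimodCell {k : Type u} [CommRing k] (A B : AlgCell k) : Type (u + 1) where
  /-- The underlying type. -/
  carrier : Type u
  [addCommGroup : AddCommGroup carrier]
  [module : Module k carrier]
  /-- The left action, `lact a m = a m`. -/
  lact : A.carrier →ₐ[k] Module.End k carrier
  /-- The right action, `ract (op b) m = m b`. -/
  ract : B.carrierᵐᵒᵖ →ₐ[k] Module.End k carrier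
  comm : ∀ a b m, lact a (ract b m) = ract b (lact a m)

namespace BimodCell

attribute [instance] BimodCell.addCommGroup BimodCell.module

variable {k : Type u} [CommRing k] {A B C D E : AlgCell k}

/-- A map of `(A, B)`-bimodules. -/
@[ext]
structure Hom (M N : BimodCell A B) : Type u where
  /-- The underlying `k`-linear map. -/
  lin : M.carrier →ₗ[k] N.carrier
  map_lact : ∀ a m, lin (M.lact a m) = N.lact a (lin m)
  map_ract : ∀ b m, lin (M.ract b m) = N.ract b (lin m)

/-- Bimodules and bimodule maps form a category. -/
instance category : CategoryTheory.Category (BimodCell A B) where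
  Hom M N := Hom M N
  id M := ⟨LinearMap.id, fun _ _ => rfl, fun _ _ => rfl⟩
  comp f g := ⟨g.lin ∘ₗ f.lin, fun a m => by simp [f.map_lact, g.map_lact],
    fun b m => by simp [f.map_ract, g.map_ract]⟩

@[ext]
theorem hom_ext {M N : BimodCell A B} {f g : M ⟶ N} (h : f.lin = g.lin) : f = g :=
  Hom.ext h

@[simp] theorem id_lin (M : BimodCell A B) :
    Hom.lin (CategoryTheory.CategoryStruct.id M) = LinearMap.id := rfl

@[simp] theorem comp_lin {M N P : BimodCell A B} (f : M ⟶ N) (g : N ⟶ P) :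
    Hom.lin (CategoryTheory.CategoryStruct.comp f g) = g.lin ∘ₗ f.lin := rfl

/-- A pair of mutually inverse bimodule maps, from one of them and an inverse function. -/
def isoOfInverse {M N : BimodCell A B} (f : M ⟶ N) (g : N.carrier →ₗ[k] M.carrier)
    (h₁ : g ∘ₗ f.lin = LinearMap.id) (h₂ : f.lin ∘ₗ g = LinearMap.id) : M ≅ N where
  hom := f
  inv := ⟨g, fun a n => by
      have h1 := fun x => LinearMap.congr_fun h₁ x
      have h2 := fun x => LinearMap.congr_fun h₂ x
      simp only [LinearMap.comp_apply, LinearMap.id_apply] at h1 h2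
      rw [← h1 (M.lact a (g n)), f.map_lact, h2], fun b n => by
      have h1 := fun x => LinearMap.congr_fun h₁ x
      have h2 := fun x => LinearMap.congr_fun h₂ x
      simp only [LinearMap.comp_apply, LinearMap.id_apply] at h1 h2
      rw [← h1 (M.ract b (g n)), f.map_ract, h2]⟩
  hom_inv_id := by ext1; exact h₁
  inv_hom_id := by ext1; exact h₂

/-! ### The tensor product of bimodules -/

/-- The submodule of `M ⊗[k] N` spanned by all `m b ⊗ n - m ⊗ b n`. -/
def balancedRel (M : BimodCell A B) (N : BimodCell B C) :
    Submodule k (M.carrier ⊗[k] N.carrier) :=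
  Submodule.span k {x | ∃ (m : M.carrier) (b : B.carrier) (n : N.carrier),
    x = M.ract (MulOpposite.op b) m ⊗ₜ[k] n - m ⊗ₜ[k] N.lact b n}

/-- The `k`-module underlying `M ⊗_B N`. -/
abbrev TensorCarrier (M : BimodCell A B) (N : BimodCell B C) : Type u :=
  (M.carrier ⊗[k] N.carrier) ⧸ balancedRel M N

/-- The class of `m ⊗ n` in `M ⊗_B N`. -/
def tmk (M : BimodCell A B) (N : BimodCell B C) :
    M.carrier →ₗ[k] N.carrier →ₗ[k] TensorCarrier M N :=
  (TensorProduct.mk k M.carrier N.carrier).compr₂ (balancedRel M N).mkQ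

theorem tmk_balanced (M : BimodCell A B) (N : BimodCell B C) (m : M.carrier) (b : B.carrier)
    (n : N.carrier) : tmk M N (M.ract (MulOpposite.op b) m) n = tmk M N m (N.lact b n) :=
  (Submodule.Quotient.eq _).2 (Submodule.subset_span ⟨m, b, n, rfl⟩)

theorem tensor_linext {M : BimodCell A B} {N : BimodCell B C} {P : Type u} [AddCommGroup P]
    [Module k P] {f g : TensorCarrier M N →ₗ[k] P}
    (h : ∀ m n, f (tmk M N m n) = g (tmk M N m n)) : f = g := by
  apply Submodule.linearMap_qext
  apply TensorProduct.ext'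
  exact h

/-- The linear map out of `M ⊗_B N` given by a `B`-balanced bilinear map. -/
def tlift {M : BimodCell A B} {N : BimodCell B C} {P : Type u} [AddCommGroup P] [Module k P]
    (f : M.carrier →ₗ[k] N.carrier →ₗ[k] P)
    (hf : ∀ m b n, f (M.ract (MulOpposite.op b) m) n = f m (N.lact b n)) :
    TensorCarrier M N →ₗ[k] P :=
  (balancedRel M N).liftQ (TensorProduct.lift f) (by
    rw [balancedRel, Submodule.span_le]
    rintro _ ⟨m, b, n, rfl⟩
    simp [hf])

@[simp]
theorem tlift_tmk {M : BimodCell A B} {N : BimodCell B C} {P : Type u} [AddCommGroup P]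
    [Module k P] (f : M.carrier →ₗ[k] N.carrier →ₗ[k] P)
    (hf : ∀ m b n, f (M.ract (MulOpposite.op b) m) n = f m (N.lact b n)) (m : M.carrier)
    (n : N.carrier) : tlift f hf (tmk M N m n) = f m n := by
  simp [tlift, tmk]

/-- The map `f ⊗ g` of tensor products, for maps that respect the middle actions. -/
def tmap {M : BimodCell A B} {N : BimodCell B C} {A' C' : AlgCell k} {M' : BimodCell A' B}
    {N' : BimodCell B C'} (f : M.carrier →ₗ[k] M'.carrier) (g : N.carrier →ₗ[k] N'.carrier)
    (hf : ∀ b m, f (M.ract b m) = M'.ract b (f m))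
    (hg : ∀ b n, g (N.lact b n) = N'.lact b (g n)) :
    TensorCarrier M N →ₗ[k] TensorCarrier M' N' :=
  tlift ((tmk M' N').compl₁₂ f g) (fun m b n => by
    simp only [LinearMap.compl₁₂_apply, hf, hg, tmk_balanced])

@[simp]
theorem tmap_tmk {M : BimodCell A B} {N : BimodCell B C} {A' C' : AlgCell k}
    {M' : BimodCell A' B} {N' : BimodCell B C'} (f : M.carrier →ₗ[k] M'.carrier)
    (g : N.carrier →ₗ[k] N'.carrier) (hf : ∀ b m, f (M.ract b m) = M'.ract b (f m))
    (hg : ∀ b n, g (N.lact b n) = N'.lact b (g n)) (m : M.carrier) (n : N.carrier) :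
    tmap (M' := M') (N' := N') f g hf hg (tmk M N m n) = tmk M' N' (f m) (g n) := by
  simp [tmap]

/-- The `(A, C)`-bimodule `M ⊗_B N`. -/
abbrev tensor (M : BimodCell A B) (N : BimodCell B C) : BimodCell A C where
  carrier := TensorCarrier M N
  lact := AlgHom.ofLinearMap
    { toFun := fun a => tmap (M' := M) (N' := N) (M.lact a) LinearMap.id
        (fun b m => M.comm a b m) (fun _ _ => rfl)
      map_add' := fun a b => tensor_linext fun m n => by simp
      map_smul' := fun a b => tensor_linext fun m n => by simp }
    (tensor_linext fun m n => by simp)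
    (fun a b => tensor_linext fun m n => by simp)
  ract := AlgHom.ofLinearMap
    { toFun := fun c => tmap (M' := M) (N' := N) LinearMap.id (N.ract c)
        (fun _ _ => rfl) (fun b n => (N.comm b c n).symm)
      map_add' := fun a b => tensor_linext fun m n => by simp
      map_smul' := fun a b => tensor_linext fun m n => by simp }
    (tensor_linext fun m n => by simp)
    (fun a b => tensor_linext fun m n => by simp)
  comm a c x := by
    exact LinearMap.congr_fun (f := tmap (M' := M) (N' := N) (M.lact a) LinearMap.id
        (fun b m => M.comm a b m) (fun _ _ => rfl) ∘ₗ
      tmap (M' := M) (N' := N) LinearMap.id (N.ract c) (fun _ _ => rfl)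
        (fun b n => (N.comm b c n).symm))
      (g := tmap (M' := M) (N' := N) LinearMap.id (N.ract c) (fun _ _ => rfl)
        (fun b n => (N.comm b c n).symm) ∘ₗ
      tmap (M' := M) (N' := N) (M.lact a) LinearMap.id
        (fun b m => M.comm a b m) (fun _ _ => rfl)) (tensor_linext fun m n => by simp) x

@[simp] theorem tensor_lact_tmk (M : BimodCell A B) (N : BimodCell B C) (a : A.carrier)
    (m : M.carrier) (n : N.carrier) :
    (tensor M N).lact a (tmk M N m n) = tmk M N (M.lact a m) n :=
  tmap_tmk (M' := M) (N' := N) (M.lact a) LinearMap.id (fun b m => M.comm a b m)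
    (fun _ _ => rfl) m n

@[simp] theorem tensor_ract_tmk (M : BimodCell A B) (N : BimodCell B C) (c : C.carrierᵐᵒᵖ)
    (m : M.carrier) (n : N.carrier) :
    (tensor M N).ract c (tmk M N m n) = tmk M N m (N.ract c n) :=
  tmap_tmk (M' := M) (N' := N) LinearMap.id (N.ract c) (fun _ _ => rfl)
    (fun b n => (N.comm b c n).symm) m n

/-- Two bimodule maps out of `M ⊗_B N` agree if they agree on all `m ⊗ n`. -/
theorem tensor_homext {M : BimodCell A B} {N : BimodCell B C} {P : BimodCell A C}
    {f g : tensor M N ⟶ P} (h : ∀ m n, f.lin (tmk M N m n) = g.lin (tmk M N m n)) : f = g :=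
  hom_ext (tensor_linext h)

/-- A bimodule map out of `M ⊗_B N`, from a balanced bilinear map. -/
def homOfBalanced {M : BimodCell A B} {N : BimodCell B C} {P : BimodCell A C}
    (f : M.carrier →ₗ[k] N.carrier →ₗ[k] P.carrier)
    (hf : ∀ m b n, f (M.ract (MulOpposite.op b) m) n = f m (N.lact b n))
    (hl : ∀ a m n, f (M.lact a m) n = P.lact a (f m n))
    (hr : ∀ c m n, f m (N.ract c n) = P.ract c (f m n)) : tensor M N ⟶ P :=
  Hom.mk (M := tensor M N) (N := P) (tlift f hf)
    (fun a x => LinearMap.congr_fun (f := tlift f hf ∘ₗ (tensor M N).lact a)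
      (g := P.lact a ∘ₗ tlift f hf) (tensor_linext fun m n => by
        rw [LinearMap.comp_apply, LinearMap.comp_apply, tensor_lact_tmk]; simp [hl]) x)
    (fun c x => LinearMap.congr_fun (f := tlift f hf ∘ₗ (tensor M N).ract c)
      (g := P.ract c ∘ₗ tlift f hf) (tensor_linext fun m n => by
        rw [LinearMap.comp_apply, LinearMap.comp_apply, tensor_ract_tmk]; simp [hr]) x)

@[simp] theorem homOfBalanced_tmk {M : BimodCell A B} {N : BimodCell B C} {P : BimodCell A C}
    (f : M.carrier →ₗ[k] N.carrier →ₗ[k] P.carrier)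
    (hf : ∀ m b n, f (M.ract (MulOpposite.op b) m) n = f m (N.lact b n))
    (hl : ∀ a m n, f (M.lact a m) n = P.lact a (f m n))
    (hr : ∀ c m n, f m (N.ract c n) = P.ract c (f m n)) (m : M.carrier) (n : N.carrier) :
    (homOfBalanced f hf hl hr).lin (tmk M N m n) = f m n :=
  tlift_tmk f hf m n

/-- The tensor product of two bimodule maps. -/
def tensorHom {M M' : BimodCell A B} {N N' : BimodCell B C} (f : M ⟶ M') (g : N ⟶ N') :
    tensor M N ⟶ tensor M' N' :=
  homOfBalanced (P := tensor M' N') ((tmk M' N').compl₁₂ f.lin g.lin)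
    (fun m b n => by simp only [LinearMap.compl₁₂_apply, f.map_ract, g.map_lact, tmk_balanced])
    (fun a m n => by simp [f.map_lact])
    (fun c m n => by simp [g.map_ract])

@[simp] theorem tensorHom_tmk {M M' : BimodCell A B} {N N' : BimodCell B C} (f : M ⟶ M')
    (g : N ⟶ N') (m : M.carrier) (n : N.carrier) :
    (tensorHom f g).lin (tmk M N m n) = tmk M' N' (f.lin m) (g.lin n) :=
  homOfBalanced_tmk (P := tensor M' N') _ _ _ _ _ _

/-- The identity 1-cell: `A` as an `(A, A)`-bimodule. -/
abbrev unit (A : AlgCell k) : BimodCell A A where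
  carrier := A.carrier
  lact := Algebra.lsmul k k A.carrier
  ract := Algebra.lsmul k k A.carrier
  comm a b m := by simp [mul_assoc]

theorem unit_lact (a m : A.carrier) : (unit A).lact a m = a * m := rfl

theorem unit_ract (a : A.carrierᵐᵒᵖ) (m : A.carrier) : (unit A).ract a m = m * a.unop := rfl

/-- The map `A ⊗_A M → M`, `a ⊗ m ↦ a m`. -/
def leftUnitorHom (M : BimodCell A B) : tensor (unit A) M ⟶ M :=
  homOfBalanced (M := unit A) M.lact.toLinearMap
    (fun a b m => LinearMap.congr_fun (map_mul M.lact a b) m)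
    (fun a b m => LinearMap.congr_fun (map_mul M.lact a b) m)
    (fun b a m => M.comm a b m)

@[simp] theorem leftUnitorHom_tmk (M : BimodCell A B) (a : A.carrier) (m : M.carrier) :
    (leftUnitorHom M).lin (tmk (unit A) M a m) = M.lact a m :=
  homOfBalanced_tmk (M := unit A) M.lact.toLinearMap _ _ _ a m

/-- The left unitor `A ⊗_A M ≅ M`, `a ⊗ m ↦ a m`. -/
def leftUnitorIso (M : BimodCell A B) : tensor (unit A) M ≅ M :=
  isoOfInverse (leftUnitorHom M) (tmk (unit A) M (1 : A.carrier))
    (tensor_linext (M := unit A) fun a m => by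
      refine (congrArg (tmk (unit A) M (1 : A.carrier)) (leftUnitorHom_tmk M a m)).trans ?_
      refine (tmk_balanced (unit A) M (1 : A.carrier) a m).symm.trans ?_
      exact congrArg (fun x => tmk (unit A) M x m) (one_mul a))
    (LinearMap.ext fun m =>
      (leftUnitorHom_tmk M 1 m).trans (LinearMap.congr_fun (map_one M.lact) m))

@[simp] theorem leftUnitorIso_hom_tmk (M : BimodCell A B) (a : A.carrier) (m : M.carrier) :
    Hom.lin (leftUnitorIso M).hom (tmk (unit A) M a m) = M.lact a m :=
  leftUnitorHom_tmk M a m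

/-- The map `M ⊗_B B → M`, `m ⊗ b ↦ m b`. -/
def rightUnitorHom (M : BimodCell A B) : tensor M (unit B) ⟶ M :=
  homOfBalanced (N := unit B)
    (M.ract.toLinearMap ∘ₗ (MulOpposite.opLinearEquiv k).toLinearMap).flip
    (fun m b c => (LinearMap.congr_fun
      (map_mul M.ract (MulOpposite.op c) (MulOpposite.op b)) m).symm)
    (fun a m b => (M.comm a (MulOpposite.op b) m).symm)
    (fun c m b => LinearMap.congr_fun (map_mul M.ract c (MulOpposite.op b)) m)

@[simp] theorem rightUnitorHom_tmk (M : BimodCell A B) (m : M.carrier) (b : B.carrier) :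
    (rightUnitorHom M).lin (tmk M (unit B) m b) = M.ract (MulOpposite.op b) m :=
  homOfBalanced_tmk (N := unit B)
    (M.ract.toLinearMap ∘ₗ (MulOpposite.opLinearEquiv k).toLinearMap).flip _ _ _ m b

/-- The right unitor `M ⊗_B B ≅ M`, `m ⊗ b ↦ m b`. -/
def rightUnitorIso (M : BimodCell A B) : tensor M (unit B) ≅ M :=
  isoOfInverse (rightUnitorHom M) ((tmk M (unit B)).flip (1 : B.carrier))
    (tensor_linext (N := unit B) fun m b => by
      refine (congrArg (fun x => tmk M (unit B) x (1 : B.carrier))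
        (rightUnitorHom_tmk M m b)).trans ?_
      refine (tmk_balanced M (unit B) m b (1 : B.carrier)).trans ?_
      exact congrArg (tmk M (unit B) m) (mul_one b))
    (LinearMap.ext fun m =>
      (rightUnitorHom_tmk M m 1).trans (LinearMap.congr_fun (map_one M.ract) m))

@[simp] theorem rightUnitorIso_hom_tmk (M : BimodCell A B) (m : M.carrier) (b : B.carrier) :
    Hom.lin (rightUnitorIso M).hom (tmk M (unit B) m b) = M.ract (MulOpposite.op b) m :=
  rightUnitorHom_tmk M m b

/-- The linear map `(M ⊗_B N) → Hom_k(P, M ⊗_B (N ⊗_C P))`, `m ⊗ n ↦ (p ↦ m ⊗ (n ⊗ p))`. -/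
def assocAux (M : BimodCell A B) (N : BimodCell B C) (P : BimodCell C D) :
    TensorCarrier M N →ₗ[k] P.carrier →ₗ[k] TensorCarrier M (tensor N P) :=
  tlift (M := M) (N := N)
    { toFun := fun m => (tmk N P).compr₂ (tmk M (tensor N P) m)
      map_add' := fun m m' => by ext n p; simp
      map_smul' := fun c m => by ext n p; simp }
    (fun m b n => LinearMap.ext fun p =>
      (tmk_balanced M (tensor N P) m b (tmk N P n p)).trans
        (congrArg (tmk M (tensor N P) m) (tensor_lact_tmk N P b n p)))

@[simp] theorem assocAux_tmk (M : BimodCell A B) (N : BimodCell B C) (P : BimodCell C D)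
    (m : M.carrier) (n : N.carrier) (p : P.carrier) :
    assocAux M N P (tmk M N m n) p = tmk M (tensor N P) m (tmk N P n p) :=
  LinearMap.congr_fun (tlift_tmk (M := M) (N := N) _ _ m n) p

/-- The map `(M ⊗_B N) ⊗_C P → M ⊗_B (N ⊗_C P)`, `(m ⊗ n) ⊗ p ↦ m ⊗ (n ⊗ p)`. -/
def assocHom (M : BimodCell A B) (N : BimodCell B C) (P : BimodCell C D) :
    tensor (tensor M N) P ⟶ tensor M (tensor N P) :=
  homOfBalanced (M := tensor M N) (N := P) (P := tensor M (tensor N P)) (assocAux M N P)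
    (fun x c p => LinearMap.congr_fun
      (f := (assocAux M N P).flip p ∘ₗ (tensor M N).ract (MulOpposite.op c))
      (g := (assocAux M N P).flip (P.lact c p))
      (tensor_linext (M := M) (N := N) fun m n => by
        rw [LinearMap.comp_apply, tensor_ract_tmk, LinearMap.flip_apply, LinearMap.flip_apply,
          assocAux_tmk, assocAux_tmk, tmk_balanced]) x)
    (fun a x p => LinearMap.congr_fun
      (f := (assocAux M N P).flip p ∘ₗ (tensor M N).lact a)
      (g := (tensor M (tensor N P)).lact a ∘ₗ (assocAux M N P).flip p)
      (tensor_linext (M := M) (N := N) fun m n => by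
        rw [LinearMap.comp_apply, LinearMap.comp_apply, tensor_lact_tmk, LinearMap.flip_apply,
          LinearMap.flip_apply, assocAux_tmk, assocAux_tmk, tensor_lact_tmk]) x)
    (fun d x p => LinearMap.congr_fun
      (f := (assocAux M N P).flip (P.ract d p))
      (g := (tensor M (tensor N P)).ract d ∘ₗ (assocAux M N P).flip p)
      (tensor_linext (M := M) (N := N) fun m n => by
        rw [LinearMap.comp_apply, LinearMap.flip_apply,
          LinearMap.flip_apply, assocAux_tmk, assocAux_tmk, tensor_ract_tmk,
          tensor_ract_tmk]) x)

@[simp] theorem assocHom_tmk (M : BimodCell A B) (N : BimodCell B C) (P : BimodCell C D)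
    (m : M.carrier) (n : N.carrier) (p : P.carrier) :
    (assocHom M N P).lin (tmk (tensor M N) P (tmk M N m n) p) =
      tmk M (tensor N P) m (tmk N P n p) :=
  (homOfBalanced_tmk (M := tensor M N) (N := P) (P := tensor M (tensor N P))
    (assocAux M N P) _ _ _ (tmk M N m n) p).trans (assocAux_tmk M N P m n p)

/-- For fixed `m`, the linear map `N ⊗_C P → (M ⊗_B N) ⊗_C P`, `n ⊗ p ↦ (m ⊗ n) ⊗ p`. -/
def assocInvAux (M : BimodCell A B) (N : BimodCell B C) (P : BimodCell C D) (m : M.carrier) :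
    TensorCarrier N P →ₗ[k] TensorCarrier (tensor M N) P :=
  tlift (M := N) (N := P) (tmk (tensor M N) P ∘ₗ tmk M N m)
    (fun n c p => (congrArg (fun x => tmk (tensor M N) P x p)
      (tensor_ract_tmk M N (MulOpposite.op c) m n)).symm.trans
        (tmk_balanced (tensor M N) P (tmk M N m n) c p))

@[simp] theorem assocInvAux_tmk (M : BimodCell A B) (N : BimodCell B C) (P : BimodCell C D)
    (m : M.carrier) (n : N.carrier) (p : P.carrier) :
    assocInvAux M N P m (tmk N P n p) = tmk (tensor M N) P (tmk M N m n) p :=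
  tlift_tmk (M := N) (N := P) _ _ n p

/-- The linear map `M ⊗_B (N ⊗_C P) → (M ⊗_B N) ⊗_C P`, `m ⊗ (n ⊗ p) ↦ (m ⊗ n) ⊗ p`. -/
def assocInv (M : BimodCell A B) (N : BimodCell B C) (P : BimodCell C D) :
    TensorCarrier M (tensor N P) →ₗ[k] TensorCarrier (tensor M N) P :=
  tlift (M := M) (N := tensor N P)
    { toFun := assocInvAux M N P
      map_add' := fun m m' => tensor_linext (M := N) (N := P) fun n p => by
        rw [LinearMap.add_apply]
        simp only [assocInvAux_tmk, map_add, LinearMap.add_apply]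
      map_smul' := fun c m => tensor_linext (M := N) (N := P) fun n p => by
        rw [RingHom.id_apply, LinearMap.smul_apply]
        simp only [assocInvAux_tmk, map_smul, LinearMap.smul_apply] }
    (fun m b x => LinearMap.congr_fun (f := assocInvAux M N P (M.ract (MulOpposite.op b) m))
      (g := assocInvAux M N P m ∘ₗ (tensor N P).lact b)
      (tensor_linext (M := N) (N := P) fun n p => by
        rw [LinearMap.comp_apply, tensor_lact_tmk, assocInvAux_tmk, assocInvAux_tmk,
          tmk_balanced]) x)

@[simp] theorem assocInv_tmk (M : BimodCell A B) (N : BimodCell B C) (P : BimodCell C D)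
    (m : M.carrier) (n : N.carrier) (p : P.carrier) :
    assocInv M N P (tmk M (tensor N P) m (tmk N P n p)) =
      tmk (tensor M N) P (tmk M N m n) p :=
  (tlift_tmk (M := M) (N := tensor N P) _ _ m (tmk N P n p)).trans (assocInvAux_tmk M N P m n p)

theorem tensor_linext_left {M : BimodCell A B} {N : BimodCell B C} {P : BimodCell C D}
    {Q : Type u} [AddCommGroup Q] [Module k Q] {f g : TensorCarrier (tensor M N) P →ₗ[k] Q}
    (h : ∀ m n p, f (tmk (tensor M N) P (tmk M N m n) p) =
      g (tmk (tensor M N) P (tmk M N m n) p)) : f = g :=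
  tensor_linext (M := tensor M N) fun x p =>
    LinearMap.congr_fun (f := f ∘ₗ (tmk (tensor M N) P).flip p)
      (g := g ∘ₗ (tmk (tensor M N) P).flip p) (tensor_linext (M := M) (N := N) fun m n => h m n p) x

theorem tensor_linext_right {M : BimodCell A B} {N : BimodCell B C} {P : BimodCell C D}
    {Q : Type u} [AddCommGroup Q] [Module k Q] {f g : TensorCarrier M (tensor N P) →ₗ[k] Q}
    (h : ∀ m n p, f (tmk M (tensor N P) m (tmk N P n p)) =
      g (tmk M (tensor N P) m (tmk N P n p))) : f = g :=
  tensor_linext (N := tensor N P) fun m x =>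
    LinearMap.congr_fun (f := f ∘ₗ tmk M (tensor N P) m)
      (g := g ∘ₗ tmk M (tensor N P) m) (tensor_linext (M := N) (N := P) fun n p => h m n p) x

/-- The associator `(M ⊗_B N) ⊗_C P ≅ M ⊗_B (N ⊗_C P)`, `(m ⊗ n) ⊗ p ↦ m ⊗ (n ⊗ p)`. -/
def associatorIso (M : BimodCell A B) (N : BimodCell B C) (P : BimodCell C D) :
    tensor (tensor M N) P ≅ tensor M (tensor N P) :=
  isoOfInverse (assocHom M N P) (assocInv M N P)
    (tensor_linext_left (M := M) (N := N) (P := P) fun m n p =>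
      (congrArg (assocInv M N P) (assocHom_tmk M N P m n p)).trans (assocInv_tmk M N P m n p))
    (tensor_linext_right (M := M) (N := N) (P := P) fun m n p =>
      (congrArg (assocHom M N P).lin (assocInv_tmk M N P m n p)).trans
        (assocHom_tmk M N P m n p))

@[simp] theorem associatorIso_hom_tmk (M : BimodCell A B) (N : BimodCell B C)
    (P : BimodCell C D) (m : M.carrier) (n : N.carrier) (p : P.carrier) :
    Hom.lin (associatorIso M N P).hom (tmk (tensor M N) P (tmk M N m n) p) =
      tmk M (tensor N P) m (tmk N P n p) :=
  assocHom_tmk M N P m n p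

@[simp] theorem associatorIso_inv_tmk (M : BimodCell A B) (N : BimodCell B C)
    (P : BimodCell C D) (m : M.carrier) (n : N.carrier) (p : P.carrier) :
    Hom.lin (associatorIso M N P).inv (tmk M (tensor N P) m (tmk N P n p)) =
      tmk (tensor M N) P (tmk M N m n) p :=
  assocInv_tmk M N P m n p

/-! ### The axioms of a bicategory -/

open CategoryTheory

theorem tensorHom_id (M : BimodCell A B) (N : BimodCell B C) :
    tensorHom (𝟙 M) (𝟙 N) = 𝟙 (tensor M N) :=
  tensor_homext fun m n => by rw [tensorHom_tmk]; rfl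

theorem tensorHom_comp {M M' M'' : BimodCell A B} {N N' N'' : BimodCell B C} (f : M ⟶ M')
    (f' : M' ⟶ M'') (g : N ⟶ N') (g' : N' ⟶ N'') :
    tensorHom (f ≫ f') (g ≫ g') = tensorHom f g ≫ tensorHom f' g' :=
  tensor_homext fun m n => by
    rw [comp_lin, LinearMap.comp_apply, tensorHom_tmk, tensorHom_tmk, tensorHom_tmk]; rfl

theorem leftUnitor_naturality {M N : BimodCell A B} (f : M ⟶ N) :
    tensorHom (𝟙 (unit A)) f ≫ (leftUnitorIso N).hom = (leftUnitorIso M).hom ≫ f :=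
  tensor_homext (M := unit A) fun a m => by
    rw [comp_lin, comp_lin, LinearMap.comp_apply, LinearMap.comp_apply, tensorHom_tmk,
      leftUnitorIso_hom_tmk, leftUnitorIso_hom_tmk, f.map_lact]
    rfl

theorem rightUnitor_naturality {M N : BimodCell A B} (f : M ⟶ N) :
    tensorHom f (𝟙 (unit B)) ≫ (rightUnitorIso N).hom = (rightUnitorIso M).hom ≫ f :=
  tensor_homext (N := unit B) fun m b => by
    rw [comp_lin, comp_lin, LinearMap.comp_apply, LinearMap.comp_apply, tensorHom_tmk,
      rightUnitorIso_hom_tmk, rightUnitorIso_hom_tmk, f.map_ract]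
    rfl

theorem associator_naturality {M M' : BimodCell A B} {N N' : BimodCell B C}
    {P P' : BimodCell C D} (f : M ⟶ M') (g : N ⟶ N') (h : P ⟶ P') :
    tensorHom (tensorHom f g) h ≫ (associatorIso M' N' P').hom =
      (associatorIso M N P).hom ≫ tensorHom f (tensorHom g h) :=
  hom_ext (tensor_linext_left (M := M) (N := N) fun m n p => by
    rw [comp_lin, comp_lin, LinearMap.comp_apply, LinearMap.comp_apply, tensorHom_tmk,
      tensorHom_tmk, associatorIso_hom_tmk, associatorIso_hom_tmk, tensorHom_tmk, tensorHom_tmk])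

theorem pentagon_tensor (M : BimodCell A B) (N : BimodCell B C) (P : BimodCell C D)
    (Q : BimodCell D E) :
    tensorHom (associatorIso M N P).hom (𝟙 Q) ≫ (associatorIso M (tensor N P) Q).hom ≫
        tensorHom (𝟙 M) (associatorIso N P Q).hom =
      (associatorIso (tensor M N) P Q).hom ≫ (associatorIso M N (tensor P Q)).hom :=
  tensor_homext (M := tensor (tensor M N) P) fun x q =>
    LinearMap.congr_fun
      (f := Hom.lin (tensorHom (associatorIso M N P).hom (𝟙 Q) ≫
        (associatorIso M (tensor N P) Q).hom ≫ tensorHom (𝟙 M) (associatorIso N P Q).hom) ∘ₗ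
          (tmk (tensor (tensor M N) P) Q).flip q)
      (g := Hom.lin ((associatorIso (tensor M N) P Q).hom ≫
        (associatorIso M N (tensor P Q)).hom) ∘ₗ (tmk (tensor (tensor M N) P) Q).flip q)
      (tensor_linext_left (M := M) (N := N) (P := P) fun m n p => by
        rw [LinearMap.comp_apply, LinearMap.comp_apply, LinearMap.flip_apply, comp_lin, comp_lin,
          comp_lin, LinearMap.comp_apply, LinearMap.comp_apply, LinearMap.comp_apply,
          tensorHom_tmk, associatorIso_hom_tmk, associatorIso_hom_tmk, tensorHom_tmk,
          associatorIso_hom_tmk, associatorIso_hom_tmk]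
        refine Eq.trans ?_ (associatorIso_hom_tmk M N (tensor P Q) m n (tmk P Q p q)).symm
        rfl) x

theorem triangle_tensor (M : BimodCell A B) (N : BimodCell B C) :
    (associatorIso M (unit B) N).hom ≫ tensorHom (𝟙 M) (leftUnitorIso N).hom =
      tensorHom (rightUnitorIso M).hom (𝟙 N) :=
  hom_ext (tensor_linext_left (M := M) (N := unit B) fun m b n => by
    rw [comp_lin, LinearMap.comp_apply, associatorIso_hom_tmk, tensorHom_tmk, tensorHom_tmk,
      leftUnitorIso_hom_tmk, rightUnitorIso_hom_tmk]
    exact (tmk_balanced M N m b n).symm)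

end BimodCell

namespace AlgCell

open CategoryTheory BimodCell

variable {k : Type u} [CommRing k]

/-- The bicategory of `k`-algebras, bimodules and bimodule maps. A 1-cell `A ⟶ B` is an
`(A, B)`-bimodule, and the composite of `M : A ⟶ B` and `N : B ⟶ C` is `M ⊗_B N : A ⟶ C`. -/
instance bicategory : Bicategory.{u, u + 1, u + 1} (AlgCell k) where
  Hom A B := BimodCell A B
  id A := unit A
  comp M N := tensor M N
  homCategory _ _ := BimodCell.category
  whiskerLeft M _ _ f := tensorHom (𝟙 M) f
  whiskerRight f N := tensorHom f (𝟙 N)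
  associator M N P := associatorIso M N P
  leftUnitor M := leftUnitorIso M
  rightUnitor M := rightUnitorIso M
  whiskerLeft_id M N := tensorHom_id M N
  whiskerLeft_comp M _ _ _ f g := tensorHom_comp (𝟙 M) (𝟙 M) f g
  id_whiskerLeft {_ _ M N} f :=
    ((Iso.eq_comp_inv (leftUnitorIso N)).2 (leftUnitor_naturality f)).trans
      (Category.assoc _ _ _)
  comp_whiskerLeft M N P P' f :=
    ((Iso.eq_comp_inv (associatorIso M N P')).2 (by
      rw [← tensorHom_id]; exact associator_naturality (𝟙 M) (𝟙 N) f)).trans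
        (Category.assoc _ _ _)
  id_whiskerRight M N := tensorHom_id M N
  comp_whiskerRight f g N := tensorHom_comp f g (𝟙 N) (𝟙 N)
  whiskerRight_id {_ _ M N} f :=
    ((Iso.eq_comp_inv (rightUnitorIso N)).2 (rightUnitor_naturality f)).trans
      (Category.assoc _ _ _)
  whiskerRight_comp {_ _ _ _ M M'} f N P :=
    (Iso.eq_inv_comp (associatorIso M N P)).2 (by
      rw [← tensorHom_id]; exact (associator_naturality f (𝟙 N) (𝟙 P)).symm)
  whisker_assoc M N N' f P :=
    ((Iso.eq_comp_inv (associatorIso M N' P)).2 (associator_naturality (𝟙 M) f (𝟙 P))).trans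
      (Category.assoc _ _ _)
  whisker_exchange {_ _ _ M M' N N'} f g :=
    (tensorHom_comp (𝟙 M) f g (𝟙 N')).symm.trans (by
      rw [Category.id_comp, Category.comp_id]
      exact (congrArg₂ tensorHom (Category.comp_id f).symm (Category.id_comp g).symm).trans
        (tensorHom_comp f (𝟙 M') (𝟙 N) g))
  pentagon M N P Q := pentagon_tensor M N P Q
  triangle M N := triangle_tensor M N

end AlgCell

/-! ### Invertible bimodules and Eilenberg–Watts equivalence -/

section Invertible

open CategoryTheory
open scoped Bicategory

/-- A 1-cell `X : a ⟶ b` is invertible if it is a member of a dual pair `(X, Y)` whose unit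
`𝟙 a ⟶ X ≫ Y` and counit `Y ≫ X ⟶ 𝟙 b` are isomorphisms. (A dual pair is an adjunction in the
bicategory: two such 2-cells that satisfy the two triangle identities.) -/
def IsInvertibleCell {𝓑 : Type*} [Bicategory 𝓑] {a b : 𝓑} (X : a ⟶ b) : Prop :=
  ∃ (Y : b ⟶ a) (p : Bicategory.Adjunction X Y), IsIso p.unit ∧ IsIso p.counit

/-- Two 0-cells of a bicategory are Eilenberg–Watts equivalent if there is an invertible 1-cell
from the first to the second. -/
def EilenbergWattsEquivalent {𝓑 : Type*} [Bicategory 𝓑] (a b : 𝓑) : Prop :=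
  ∃ T : a ⟶ b, IsInvertibleCell T

end Invertible

/-! ### The bimodules attached to an algebra, and the conditions on it -/

section Conditions

variable (k : Type u) [CommRing k] (A : Type u) [Ring A] [Algebra k A]

/-- The `k`-algebra `k` as a 0-cell. -/
abbrev groundCell : AlgCell k := AlgCell.of k k

/-- The enveloping algebra `A ⊗[k] Aᵐᵒᵖ` as a 0-cell. -/
abbrev envCell : AlgCell k := AlgCell.of k (A ⊗[k] Aᵐᵒᵖ)

/-- `A` as a bimodule over its enveloping algebra (on the left, `(a ⊗ op b) x = a * x * b`)
and `k` (on the right). -/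
def algebraAsBimod : envCell k A ⟶ groundCell k :=
  BimodCell.mk (A := envCell k A) (B := groundCell k) A
    (AlgHom.mulLeftRight k A)
    ((Algebra.ofId k (Module.End k A)).comp (AlgEquiv.toOpposite k k).symm.toAlgHom)
    (fun x c m => by
      simp [Algebra.ofId_apply, Module.algebraMap_end_apply])

/-- `Hom_k(A, k)` as a bimodule over `k` (on the left) and the enveloping algebra of `A`
(on the right, `(f (a ⊗ op b)) x = f (a * x * b)`). -/
def dualAsBimod : groundCell k ⟶ envCell k A :=
  BimodCell.mk (A := groundCell k) (B := envCell k A) (A →ₗ[k] k)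
    (Algebra.ofId k (Module.End k (A →ₗ[k] k)))
    (AlgHom.ofLinearMap
      { toFun := fun x => (LinearMap.llcomp k A A k).flip (AlgHom.mulLeftRight k A x.unop)
        map_add' := fun x y => by ext f m; simp
        map_smul' := fun c x => by ext f m; simp }
      (by ext f m; simp)
      (fun x y => by ext f m; simp))
    (fun c x f => by
      ext m
      simp [Algebra.ofId_apply, Module.algebraMap_end_apply])

/-- The evaluation `Hom_k(A, k) ⊗_{Aᵉ} A ⟶ k`, `f ⊗ x ↦ f x`, a map of `(k, k)`-bimodules. -/
def dualEvaluation :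
    CategoryTheory.CategoryStruct.comp (dualAsBimod k A) (algebraAsBimod k A) ⟶
      CategoryTheory.CategoryStruct.id (groundCell k) :=
  BimodCell.homOfBalanced (M := dualAsBimod k A) (N := algebraAsBimod k A)
    (P := BimodCell.unit (groundCell k)) (LinearMap.id (R := k) (M := A →ₗ[k] k))
    (fun _ _ _ => rfl)
    (fun _ _ _ => rfl)
    (fun c f x => (map_smul (show A →ₗ[k] k from f) c.unop (show A from x)).trans
      (mul_comm _ _))

/-- `A` is separable over `k`: it is projective as a module over `A ⊗[k] Aᵐᵒᵖ`, where
`(a ⊗ op b) x = a * x * b`. -/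
def IsSeparableAlgebra : Prop :=
  letI : Module (A ⊗[k] Aᵐᵒᵖ) A := instModuleTensorProductMop k A
  Module.Projective (A ⊗[k] Aᵐᵒᵖ) A

/-- `A` is central over `k`: its center is precisely `k`, i.e. the structure map is an
isomorphism from `k` onto the center of `A`. -/
def IsCentralAlgebra : Prop :=
  Function.Bijective (algebraMap k (Subalgebra.center k A))

/-- `A` is faithfully projective over `k`: both the coevaluation
`Hom_k(A, k) ⊗_k A → Hom_k(A, A)`, `f ⊗ a ↦ (x ↦ f x • a)`, and the evaluation
`Hom_k(A, k) ⊗_{Aᵉ} A → k`, `f ⊗ x ↦ f x`, are isomorphisms. (With `A` written as a right module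
over `Aᵉ ≅ (Aᵉ)ᵒᵖ`, the same quotient of `Hom_k(A, k) ⊗_k A` is `A ⊗_{Aᵉ} Hom_k(A, k)`.) -/
def IsFaithfullyProjective : Prop :=
  Function.Bijective (dualTensorHom k A A) ∧
    Function.Bijective (BimodCell.Hom.lin (dualEvaluation k A))

/-- The sandwich map `A ⊗[k] Aᵐᵒᵖ → Hom_k(A, A)`, `a ⊗ op b ↦ (x ↦ a * x * b)`, is an
isomorphism. -/
def IsSandwiched : Prop :=
  Function.Bijective (AlgHom.mulLeftRight k A)

end Conditions

/-! The cycle 1 → 4 → 2 → 3 → 1 is proved. For 1 → 4, and for the last claim, `A` itself is the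
invertible cell, with `B = Aᵐᵒᵖ`.

4 → 2: an invertible `X` identifies `A ⊗ B` with `End_k(X)`, where `X` has a finite dual basis and
trace ideal `k` (`IsInvertibleCell.exists_dualBasis`). Such an endomorphism algebra has an explicit
separability element and only scalar central elements. Both properties pass to the factor `A` by
slicing with a functional that sends `1` to `1` (`exists_separabilityElement_of_tensor`).

2 → 3: projectivity of `A` gives a separability element `e` in `Aᵉ`. It acts on `A` as a projection
onto the center `k`, hence as a functional `π` with `π 1 = 1`. The key point, `one_mem_span_env`, is
that `e` generates `Aᵉ` as a two-sided ideal: a proper ideal would vanish modulo some maximal ideal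
of `k`, because over a field a nonzero ideal of a separable algebra contains a nonzero central
element, while `e` acts nontrivially modulo every maximal ideal. Writing `1 = ∑ r i * e * s i`
yields the dual basis `r i · 1`, `π ∘ s i` of `A` and both halves of the sandwich isomorphism.

3 → 1: the dual basis defines a coevaluation, inverted through `Aᵉ ≅ End_k(A)`; one triangle
identity is the dual basis formula, and the other follows formally. -/

/-! ### Separability elements -/

section SeparabilityElement

/-- Every central element is a scalar. -/
def CentralScalars (k A : Type*) [CommRing k] [Ring A] [Algebra k A] : Prop :=
  ∀ z : A, (∀ a, a * z = z * a) → ∃ t : k, algebraMap k A t = z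

/-- A separability element `∑ i, c i ⊗ d i` of the `k`-algebra `A`. -/
structure SeparabilityElement (k A : Type*) [CommRing k] [Ring A] [Algebra k A] where
  /-- The index set of the sum. -/
  ι : Type
  [fintype : Fintype ι]
  /-- The left factors. -/
  c : ι → A
  /-- The right factors. -/
  d : ι → A
  sum_mul : ∑ i, c i * d i = 1
  balanced : ∀ a, ∑ i, (a * c i) ⊗ₜ[k] d i = ∑ i, c i ⊗ₜ[k] (d i * a)

attribute [instance] SeparabilityElement.fintype

/-- The index set `Fin n` lies in `Type`, as the field `ι` of a separability element requires. -/
theorem TensorProduct.exists_fin_sum {R M N : Type*} [CommSemiring R] [AddCommMonoid M]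
    [AddCommMonoid N] [Module R M] [Module R N] (x : M ⊗[R] N) :
    ∃ (n : ℕ) (f : Fin n → M) (g : Fin n → N), x = ∑ i, f i ⊗ₜ[R] g i := by
  obtain ⟨S, rfl⟩ := TensorProduct.exists_finset x
  refine ⟨S.card, fun i => (S.equivFin.symm i).1.1, fun i => (S.equivFin.symm i).1.2, ?_⟩
  rw [← S.sum_coe_sort]
  exact (S.equivFin.symm.sum_comp fun p : S => p.1.1 ⊗ₜ[R] p.1.2).symm

namespace SeparabilityElement

variable {k A B : Type*} [CommRing k] [Ring A] [Algebra k A] [Ring B] [Algebra k B]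

/-- The working form of `balanced`: with a suitable `f`, it moves a factor from one side of an
averaged expression to the other. -/
theorem sum_bilin (e : SeparabilityElement k A) {M : Type*} [AddCommGroup M] [Module k M]
    (f : A →ₗ[k] A →ₗ[k] M) (a : A) :
    ∑ i, f (a * e.c i) (e.d i) = ∑ i, f (e.c i) (e.d i * a) := by
  simpa using congrArg (TensorProduct.lift f) (e.balanced a)

/-- The average `∑ i, c i * a * d i`. -/
def avg (e : SeparabilityElement k A) : A →ₗ[k] A :=
  ∑ i, LinearMap.mulRight k (e.d i) ∘ₗ LinearMap.mulLeft k (e.c i)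

theorem avg_apply (e : SeparabilityElement k A) (a : A) :
    e.avg a = ∑ i, e.c i * a * e.d i := by
  simp [avg, LinearMap.sum_apply]

theorem avg_central (e : SeparabilityElement k A) (a b : A) : b * e.avg a = e.avg a * b := by
  have := e.sum_bilin ((LinearMap.mul k A).compl₁₂ (LinearMap.mulRight k a) LinearMap.id) b
  simpa [avg_apply, Finset.mul_sum, Finset.sum_mul, mul_assoc] using this

/-- A central `z` can be pulled out of the sum. Together with `avg_central`, this makes `avg` a
projection onto the center. -/
theorem avg_of_central (e : SeparabilityElement k A) (z : A) (hz : ∀ a, a * z = z * a) :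
    e.avg z = z := by
  simp_rw [avg_apply, hz, mul_assoc, ← Finset.mul_sum, e.sum_mul, mul_one]

theorem avg_one (e : SeparabilityElement k A) : e.avg 1 = 1 :=
  e.avg_of_central 1 fun a => by simp

theorem exists_avg (e : SeparabilityElement k A) (h : CentralScalars k A) (a : A) :
    ∃ t : k, algebraMap k A t = e.avg a :=
  h _ fun b => e.avg_central a b

/-- The image of a separability element under a surjective ring homomorphism, possibly over a
different base ring. -/
def map (e : SeparabilityElement k A) {K C : Type*} [CommRing K] [Algebra k K] [Ring C]
    [Algebra K C] [Algebra k C] [IsScalarTower k K C] (φ : A →ₐ[k] C)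
    (hφ : Function.Surjective φ) : SeparabilityElement K C where
  ι := e.ι
  c i := φ (e.c i)
  d i := φ (e.d i)
  sum_mul := by simp_rw [← map_mul, ← map_sum, e.sum_mul, map_one]
  balanced b := by
    obtain ⟨a, rfl⟩ := hφ b
    have := e.sum_bilin (((TensorProduct.mk K C C).restrictScalars₁₂ k k).compl₁₂
      φ.toLinearMap φ.toLinearMap) a
    simpa using this

/-- The opposite separability element. -/
def op (e : SeparabilityElement k A) : SeparabilityElement k Aᵐᵒᵖ where
  ι := e.ι
  c i := .op (e.d i)
  d i := .op (e.c i)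
  sum_mul := by
    simpa using congrArg (MulOpposite.opLinearEquiv k) e.sum_mul
  balanced b := by
    have := e.sum_bilin ((TensorProduct.mk k Aᵐᵒᵖ Aᵐᵒᵖ).flip.compl₁₂
      (MulOpposite.opLinearEquiv k).toLinearMap (MulOpposite.opLinearEquiv k).toLinearMap) b.unop
    simpa using this.symm

/-- The separability element of a tensor product. -/
def tensor (e : SeparabilityElement k A) (e' : SeparabilityElement k B) :
    SeparabilityElement k (A ⊗[k] B) where
  ι := e.ι × e'.ι
  c i := e.c i.1 ⊗ₜ e'.c i.2
  d i := e.d i.1 ⊗ₜ e'.d i.2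
  sum_mul := by
    simp_rw [Fintype.sum_prod_type, Algebra.TensorProduct.tmul_mul_tmul, ← TensorProduct.tmul_sum,
      ← TensorProduct.sum_tmul, e.sum_mul, e'.sum_mul, Algebra.TensorProduct.one_def]
  balanced x := by
    induction x with
    | zero => simp
    | add x y hx hy =>
      simp_rw [add_mul, mul_add, TensorProduct.add_tmul, TensorProduct.tmul_add,
        Finset.sum_add_distrib, hx, hy]
    | tmul a b =>
      have := congrArg₂ (fun x y => TensorProduct.tensorTensorTensorComm k A A B B (x ⊗ₜ y))
        (e.balanced a) (e'.balanced b)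
      rw [← Finset.univ_product_univ, Finset.sum_product_right, Finset.sum_product_right]
      simpa [TensorProduct.sum_tmul, TensorProduct.tmul_sum, Fintype.sum_prod_type,
        Algebra.TensorProduct.tmul_mul_tmul] using this

/-- Since `φ z` is central, averaging `z` in `A` does not change its image, and the average is
already a scalar. That `t` is this average matters later: it keeps `t` inside any two-sided ideal
containing `z`. -/
theorem centralScalars_map (e : SeparabilityElement k A) (h : CentralScalars k A)
    {K C : Type*} [CommRing K] [Algebra k K] [Ring C]
    [Algebra K C] [Algebra k C] [IsScalarTower k K C] (φ : A →ₐ[k] C)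
    (z : A) (hz : ∀ b, b * φ z = φ z * b) : ∃ t : k, algebraMap k A t = e.avg z ∧
      algebraMap k C t = φ z := by
  obtain ⟨t, ht⟩ := e.exists_avg h z
  refine ⟨t, ht, ?_⟩
  have : ∀ i, φ (e.c i * z * e.d i) = φ z * φ (e.c i * e.d i) := fun i => by
    rw [map_mul, map_mul, hz, map_mul, mul_assoc]
  rw [← φ.commutes, ht, avg_apply, map_sum]
  simp_rw [this, ← Finset.mul_sum, ← map_sum, e.sum_mul, map_one, mul_one]

theorem centralScalars_tensor (e : SeparabilityElement k A) (e' : SeparabilityElement k B)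
    (h : CentralScalars k A) (h' : CentralScalars k B) : CentralScalars k (A ⊗[k] B) := by
  intro z hz
  rw [← (e.tensor e').avg_of_central z hz]
  -- Summands of a central element need not be central, so the induction proves instead that every
  -- average is a scalar.
  clear hz
  induction z with
  | zero => exact ⟨0, by simp⟩
  | add x y hx hy =>
    obtain ⟨s, hs⟩ := hx
    obtain ⟨t, ht⟩ := hy
    exact ⟨s + t, by rw [map_add, map_add, hs, ht]⟩
  | tmul a b =>
    obtain ⟨s, hs⟩ := e.exists_avg h a
    obtain ⟨t, ht⟩ := e'.exists_avg h' b
    refine ⟨s * t, ?_⟩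
    have : (e.tensor e').avg (a ⊗ₜ b) = e.avg a ⊗ₜ e'.avg b := by
      simp [avg_apply, tensor, Fintype.sum_prod_type, TensorProduct.sum_tmul,
        TensorProduct.tmul_sum]
      exact Finset.sum_comm
    rw [this, ← hs, ← ht, map_mul]
    simp [Algebra.algebraMap_eq_smul_one,
      TensorProduct.smul_tmul', TensorProduct.tmul_smul, smul_smul, mul_comm,
      Algebra.TensorProduct.one_def]

theorem centralScalars_op (h : CentralScalars k A) : CentralScalars k Aᵐᵒᵖ := fun z hz => by
  obtain ⟨t, ht⟩ := h z.unop fun a => (congrArg MulOpposite.unop (hz (.op a))).symm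
  exact ⟨t, congrArg MulOpposite.op ht⟩

/-- Over a field, a nonzero two-sided ideal of a separable algebra contains a nonzero central
element. -/
theorem exists_central_mem {K C : Type*} [Field K] [Ring C] [Algebra K C]
    (e : SeparabilityElement K C) (T : Submodule K C) (hl : ∀ a, ∀ x ∈ T, a * x ∈ T)
    (hr : ∀ a, ∀ x ∈ T, x * a ∈ T) (hT : T ≠ ⊥) :
    ∃ z ∈ T, z ≠ 0 ∧ ∀ a, a * z = z * a := by
  -- The Maschke argument: a linear projection `P` onto `T` is averaged twice, to a right linear `G`
  -- and then to a bimodule retraction `q` onto `T`.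
  obtain ⟨p, hp⟩ := T.subtype.exists_leftInverse_of_injective T.ker_subtype
  set P : C →ₗ[K] C := T.subtype ∘ₗ p with hP
  have hPT : ∀ x, P x ∈ T := fun x => (p x).2
  have hPid : ∀ x ∈ T, P x = x := fun x hx =>
    congrArg Subtype.val (LinearMap.congr_fun hp ⟨x, hx⟩)
  set G : C →ₗ[K] C := ∑ j, LinearMap.mulRight K (e.d j) ∘ₗ P ∘ₗ LinearMap.mulRight K (e.c j)
    with hG
  have hGx : ∀ x, G x = ∑ j, P (x * e.c j) * e.d j := fun x => by
    simp [hG, LinearMap.sum_apply]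
  have hGr : ∀ x a, G x * a = G (x * a) := fun x a => by
    have := e.sum_bilin ((LinearMap.mul K C).compl₁₂ (P ∘ₗ LinearMap.mulLeft K x)
      LinearMap.id) a
    simpa [hGx, Finset.sum_mul, mul_assoc] using this.symm
  have hGid : ∀ x ∈ T, G x = x := fun x hx => by
    simp_rw [hGx, hPid _ (hr _ _ hx), mul_assoc, ← Finset.mul_sum, e.sum_mul, mul_one]
  have hGT : ∀ x, G x ∈ T := fun x => by
    rw [hGx]
    exact T.sum_mem fun j _ => hr _ _ (hPT _)
  set q : C → C := fun x => ∑ i, e.c i * G (e.d i * x) with hq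
  have hqT : ∀ x, q x ∈ T := fun x => T.sum_mem fun i _ => hl _ _ (hGT _)
  have hql : ∀ a x, a * q x = q (a * x) := fun a x => by
    have := e.sum_bilin ((LinearMap.mul K C).compl₁₂ LinearMap.id
      (G ∘ₗ LinearMap.mulRight K x)) a
    simpa [hq, Finset.mul_sum, mul_assoc] using this
  have hqr : ∀ a x, q x * a = q (x * a) := fun a x => by
    simp_rw [hq, Finset.sum_mul, mul_assoc, hGr, mul_assoc]
  have hqid : ∀ x ∈ T, q x = x := fun x hx => by
    simp_rw [hq, hGid _ (hl _ _ hx), ← mul_assoc, ← Finset.sum_mul, e.sum_mul, one_mul]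
  obtain ⟨x, hx, hx0⟩ := T.ne_bot_iff.1 hT
  -- The element `q 1` is central because `a * q 1 = q a = q 1 * a`, and nonzero because `x = q x =
  -- x * q 1` for `x` in `T`.
  refine ⟨q 1, hqT 1, fun h => hx0 ?_, fun a => by rw [hql, hqr, mul_one, one_mul]⟩
  rw [← hqid x hx, ← mul_one x, ← hql, h, mul_zero]

end SeparabilityElement

end SeparabilityElement

/-! ### Central separable algebras -/

namespace SeparabilityElement

variable {k A : Type*} [CommRing k] [Ring A] [Algebra k A]

/-- The separability element as an element of the enveloping algebra. -/
def env (e : SeparabilityElement k A) : A ⊗[k] Aᵐᵒᵖ := ∑ i, e.c i ⊗ₜ .op (e.d i)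

theorem mulLeftRight_env (e : SeparabilityElement k A) (x : A) :
    AlgHom.mulLeftRight k A e.env x = e.avg x := by
  simp [env, avg_apply, LinearMap.sum_apply]

/-- By balancedness, right multiplication by `op b` on the second leg of `e` equals left
multiplication by `b` on its first. Hence `r * e` depends only on `r · 1`. -/
theorem mul_env (e : SeparabilityElement k A) (r : A ⊗[k] Aᵐᵒᵖ) :
    r * e.env = (AlgHom.mulLeftRight k A r 1 ⊗ₜ 1) * e.env := by
  induction r with
  | zero => simp
  | add x y hx hy => simp [add_mul, TensorProduct.add_tmul, hx, hy]
  | tmul a b =>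
    have := e.sum_bilin ((TensorProduct.mk k A Aᵐᵒᵖ).compl₁₂ (LinearMap.mulLeft k a)
      (MulOpposite.opLinearEquiv k).toLinearMap) b.unop
    simpa [env, Finset.mul_sum, mul_assoc] using this.symm

/-- The trace `A → k` of a central algebra given by a separability element. -/
theorem exists_trace (e : SeparabilityElement k A) (h : CentralScalars k A)
    (hinj : Function.Injective (algebraMap k A)) :
    ∃ π : A →ₗ[k] k, π 1 = 1 ∧ ∀ x, algebraMap k A (π x) = e.avg x := by
  choose π hπ using e.exists_avg h
  refine ⟨{ toFun := π, map_add' := fun x y => hinj ?_, map_smul' := fun t x => hinj ?_ },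
    hinj ?_, hπ⟩
  · simp [hπ]
  · rw [hπ, map_smul, RingHom.id_apply, smul_eq_mul, map_mul, hπ, Algebra.smul_def]
  · simp [hπ, avg_one]

/-- A proper two-sided ideal of a central separable algebra vanishes modulo some maximal ideal of
the base ring. -/
theorem exists_maximal_of_one_notMem (e : SeparabilityElement k A) (h : CentralScalars k A)
    (T : Submodule k A) (hl : ∀ a, ∀ x ∈ T, a * x ∈ T) (hr : ∀ a, ∀ x ∈ T, x * a ∈ T)
    (h1 : (1 : A) ∉ T) :
    ∃ m : Ideal k, m.IsMaximal ∧ ∀ t ∈ T, (1 : k ⧸ m) ⊗ₜ[k] t = 0 := by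
  -- The maximal ideal is chosen to contain the scalars that lie in `T`.
  have hne : T.comap (Algebra.linearMap k A) ≠ ⊤ := fun htop => h1 <| by
    have : (1 : k) ∈ T.comap (Algebra.linearMap k A) := htop ▸ Submodule.mem_top
    rwa [Submodule.mem_comap, Algebra.linearMap_apply, map_one] at this
  obtain ⟨m, hm, hle⟩ := Ideal.exists_le_maximal _ hne
  refine ⟨m, hm, ?_⟩
  let _ : Field (k ⧸ m) := Ideal.Quotient.field m
  let φ : A →ₐ[k] (k ⧸ m) ⊗[k] A := Algebra.TensorProduct.includeRight
  have hsc : ∀ (c : k) (x : (k ⧸ m) ⊗[k] A), Ideal.Quotient.mk m c • x = c • x := fun c x =>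
    algebraMap_smul (k ⧸ m) c x
  have hφ : Function.Surjective φ := by
    intro x
    induction x with
    | zero => exact ⟨0, map_zero _⟩
    | add x y hx hy =>
      obtain ⟨a, rfl⟩ := hx
      obtain ⟨b, rfl⟩ := hy
      exact ⟨a + b, map_add _ _ _⟩
    | tmul c b =>
      obtain ⟨c, rfl⟩ := Ideal.Quotient.mk_surjective c
      refine ⟨c • b, ?_⟩
      rw [map_smul, ← hsc]
      change Ideal.Quotient.mk m c • ((1 : k ⧸ m) ⊗ₜ[k] b) = _
      rw [TensorProduct.smul_tmul', smul_eq_mul, mul_one]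
  let T' : Submodule (k ⧸ m) ((k ⧸ m) ⊗[k] A) :=
    { T.map φ.toLinearMap with
      smul_mem' := fun c x hx => by
        obtain ⟨c, rfl⟩ := Ideal.Quotient.mk_surjective c
        rw [hsc]
        exact (T.map φ.toLinearMap).smul_mem c hx }
  by_contra! hbot
  obtain ⟨t₀, ht₀, hne₀⟩ := hbot
  have hT' : T' ≠ ⊥ := fun hb => hne₀ <|
    (Submodule.mem_bot (k ⧸ m)).1 (hb ▸ ⟨t₀, ht₀, rfl⟩ : φ t₀ ∈ (⊥ : Submodule (k ⧸ m) _))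
  obtain ⟨z, hz, hz0, hzc⟩ := (e.map (K := k ⧸ m) φ hφ).exists_central_mem T'
    (fun a x hx => by
      obtain ⟨a, rfl⟩ := hφ a
      obtain ⟨t, ht, rfl⟩ := hx
      exact ⟨a * t, hl a t ht, map_mul φ _ _⟩)
    (fun a x hx => by
      obtain ⟨a, rfl⟩ := hφ a
      obtain ⟨t, ht, rfl⟩ := hx
      exact ⟨t * a, hr a t ht, map_mul φ _ _⟩) hT'
  obtain ⟨t, ht, rfl⟩ := hz
  -- The central element found in the fiber is a scalar `c` whose image in `A` is an average of `t ∈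
  -- T`. So `c` lies in `m`, and the element vanishes.
  obtain ⟨c, hc, hc'⟩ := e.centralScalars_map h (K := k ⧸ m) φ t hzc
  have hcT : c ∈ T.comap (Algebra.linearMap k A) := by
    rw [Submodule.mem_comap, Algebra.linearMap_apply, hc, avg_apply]
    exact T.sum_mem fun i _ => hr _ _ (hl _ _ ht)
  refine hz0 (hc'.symm.trans ?_)
  rw [IsScalarTower.algebraMap_apply k (k ⧸ m)]
  have : algebraMap k (k ⧸ m) c = 0 := Ideal.Quotient.eq_zero_iff_mem.2 (hle hcT)
  rw [this, map_zero]

/-- **Auslander–Goldman**: for a central separable algebra, the separability element generates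
the enveloping algebra as a two-sided ideal. -/
theorem one_mem_span_env (e : SeparabilityElement k A) (h : CentralScalars k A)
    (hinj : Function.Injective (algebraMap k A)) :
    (1 : A ⊗[k] Aᵐᵒᵖ) ∈ Submodule.span k {x | ∃ r s, x = r * e.env * s} := by
  obtain ⟨π, hπ1, -⟩ := e.exists_trace h hinj
  by_contra h1
  -- The enveloping algebra is itself central and separable, so the preceding result applies to its
  -- ideals.
  obtain ⟨m, hm, h0⟩ := (e.tensor e.op).exists_maximal_of_one_notMem
    (e.centralScalars_tensor e.op h (centralScalars_op h))
    (Submodule.span k {x | ∃ r s, x = r * e.env * s})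
    (fun a x hx => by
      induction hx using Submodule.span_induction with
      | zero => simp
      | add x y _ _ hx hy => rw [mul_add]; exact Submodule.add_mem _ hx hy
      | smul c x _ hx => rw [mul_smul_comm]; exact Submodule.smul_mem _ c hx
      | mem x hx =>
        obtain ⟨r, s, rfl⟩ := hx
        exact Submodule.subset_span ⟨a * r, s, by simp only [mul_assoc]⟩)
    (fun a x hx => by
      induction hx using Submodule.span_induction with
      | zero => simp
      | add x y _ _ hx hy => rw [add_mul]; exact Submodule.add_mem _ hx hy
      | smul c x _ hx => rw [smul_mul_assoc]; exact Submodule.smul_mem _ c hx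
      | mem x hx =>
        obtain ⟨r, s, rfl⟩ := hx
        exact Submodule.subset_span ⟨r, s * a, by simp only [mul_assoc]⟩) h1
  -- The functional `r ↦ π (r · 1)` sends `e` to `π (avg 1) = 1`, so `e` cannot vanish modulo `m`.
  have h2 := congrArg (TensorProduct.rid k (k ⧸ m) ∘ LinearMap.lTensor (k ⧸ m)
    (π ∘ₗ LinearMap.applyₗ (1 : A) ∘ₗ (AlgHom.mulLeftRight k A).toLinearMap))
    (h0 e.env (Submodule.subset_span ⟨1, 1, by simp⟩))
  have : Nontrivial (k ⧸ m) := Ideal.Quotient.nontrivial_iff.2 hm.ne_top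
  simp [mulLeftRight_env, avg_one, hπ1] at h2

end SeparabilityElement

/-- Projectivity splits `Aᵉ → A`, `r ↦ r · 1`, by some `s`. Then `s 1` is a separability element: it
is balanced because `a ⊗ 1` and `1 ⊗ op a` both send `1` to `a`. -/
theorem IsSeparableAlgebra.exists_separabilityElement {k : Type u} [CommRing k] {A : Type u}
    [Ring A] [Algebra k A] (h : IsSeparableAlgebra k A) :
    Nonempty (SeparabilityElement k A) := by
  let _ : Module (A ⊗[k] Aᵐᵒᵖ) A := instModuleTensorProductMop k A
  have : Module.Projective (A ⊗[k] Aᵐᵒᵖ) A := h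
  have hsmul : ∀ (r : A ⊗[k] Aᵐᵒᵖ) (x : A), r • x = AlgHom.mulLeftRight k A r x :=
    fun _ _ => rfl
  obtain ⟨s, hs⟩ := Module.projective_lifting_property
    (LinearMap.toSpanSingleton (A ⊗[k] Aᵐᵒᵖ) A 1) LinearMap.id
    (fun a => ⟨a ⊗ₜ 1, by simp [LinearMap.toSpanSingleton_apply, hsmul]⟩)
  have hs1 : AlgHom.mulLeftRight k A (s 1) 1 = 1 := LinearMap.congr_fun hs 1
  have hbal : ∀ a : A, a ⊗ₜ[k] (1 : Aᵐᵒᵖ) * s 1 = (1 : A) ⊗ₜ[k] MulOpposite.op a * s 1 :=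
    fun a => by
      rw [← smul_eq_mul, ← smul_eq_mul, ← map_smul, ← map_smul]
      simp [hsmul]
  obtain ⟨n, c, d, hcd⟩ := TensorProduct.exists_fin_sum (s 1)
  rw [hcd] at hs1 hbal
  refine ⟨⟨Fin n, c, fun i => (d i).unop, ?_, fun a => ?_⟩⟩
  · simpa [LinearMap.sum_apply] using hs1
  · have := congrArg (LinearMap.lTensor A (MulOpposite.opLinearEquiv k).symm.toLinearMap) (hbal a)
    simpa [Finset.mul_sum] using this

/-- The splitting is `x ↦ (x ⊗ 1) * e`, which is `Aᵉ`-linear by `mul_env`. -/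
theorem SeparabilityElement.isSeparableAlgebra {k : Type u} [CommRing k] {A : Type u}
    [Ring A] [Algebra k A] (e : SeparabilityElement k A) : IsSeparableAlgebra k A := by
  let _ : Module (A ⊗[k] Aᵐᵒᵖ) A := instModuleTensorProductMop k A
  have hsmul : ∀ (r : A ⊗[k] Aᵐᵒᵖ) (x : A), r • x = AlgHom.mulLeftRight k A r x :=
    fun _ _ => rfl
  refine Module.Projective.of_split (R := A ⊗[k] Aᵐᵒᵖ) (M := A ⊗[k] Aᵐᵒᵖ) (P := A)
    { toFun := fun x => (x ⊗ₜ[k] (1 : Aᵐᵒᵖ)) * e.env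
      map_add' := fun x y => by rw [TensorProduct.add_tmul, add_mul]
      map_smul' := fun r x => ?_ }
    (LinearMap.toSpanSingleton (A ⊗[k] Aᵐᵒᵖ) A 1) (LinearMap.ext fun x => ?_)
  · rw [RingHom.id_apply, smul_eq_mul, ← mul_assoc, e.mul_env (r * _), map_mul]
    simp [hsmul]
  · simp [LinearMap.toSpanSingleton_apply, hsmul, mulLeftRight_env, avg_one]

theorem isCentralAlgebra_iff {k : Type u} [CommRing k] {A : Type u} [Ring A] [Algebra k A] :
    IsCentralAlgebra k A ↔ CentralScalars k A ∧ Function.Injective (algebraMap k A) := by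
  constructor
  · rintro ⟨hi, hs⟩
    refine ⟨fun z hz => ?_, fun x y hxy => hi (Subtype.ext hxy)⟩
    obtain ⟨t, ht⟩ := hs ⟨z, Subalgebra.mem_center_iff.2 hz⟩
    exact ⟨t, congrArg Subtype.val ht⟩
  · rintro ⟨hs, hi⟩
    refine ⟨fun x y hxy => hi (congrArg Subtype.val hxy), fun z => ?_⟩
    obtain ⟨t, ht⟩ := hs z.1 (Subalgebra.mem_center_iff.1 z.2)
    exact ⟨t, Subtype.ext ht⟩

/-! ### Central separable algebras are faithfully projective -/

section DualBasis

variable {k M N : Type*} [CommRing k] [AddCommGroup M] [Module k M] [AddCommGroup N] [Module k N]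

theorem bijective_dualTensorHom_of_dualBasis {ι : Type*} [Fintype ι] (y : ι → M)
    (f : ι → Module.Dual k M) (h : ∀ x, ∑ i, f i x • y i = x) :
    Function.Bijective (dualTensorHom k M N) := by
  refine Function.bijective_iff_has_inverse.2
    ⟨fun φ => ∑ i, f i ⊗ₜ[k] φ (y i), fun x => ?_, fun φ => ?_⟩
  · induction x with
    | zero => simp
    | add x z hx hz =>
      simp only [map_add, LinearMap.add_apply, TensorProduct.tmul_add, Finset.sum_add_distrib]
      exact congrArg₂ (· + ·) hx hz
    | tmul g n =>
      -- The `f i` span the dual, with coefficients given by the `y i`.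
      have : ∑ i, g (y i) • f i = g := by
        ext x
        conv_rhs => rw [← h x, map_sum]
        simp [mul_comm]
      simp_rw [dualTensorHom_apply, ← TensorProduct.smul_tmul, ← TensorProduct.sum_tmul, this]
  · ext x
    conv_rhs => rw [← h x, map_sum]
    simp [LinearMap.sum_apply]

/-- A dual basis is a preimage of the identity. -/
theorem exists_dualBasis_of_surjective (h : Function.Surjective (dualTensorHom k M M)) :
    ∃ (n : ℕ) (y : Fin n → M) (f : Fin n → Module.Dual k M), ∀ x, ∑ i, f i x • y i = x := by
  obtain ⟨u, hu⟩ := h LinearMap.id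
  obtain ⟨n, f, y, rfl⟩ := TensorProduct.exists_fin_sum u
  exact ⟨n, y, f, fun x => by simpa [LinearMap.sum_apply] using LinearMap.congr_fun hu x⟩

end DualBasis

theorem SeparabilityElement.isSandwiched_and_exists_dualBasis {k A : Type u} [CommRing k] [Ring A]
    [Algebra k A] (e : SeparabilityElement k A) (h : CentralScalars k A)
    (hinj : Function.Injective (algebraMap k A)) :
    IsSandwiched k A ∧ ∃ (n : ℕ) (y : Fin n → A) (f : Fin n → Module.Dual k A),
      ∀ x, ∑ i, f i x • y i = x := by
  obtain ⟨π, hπ1, hπ⟩ := e.exists_trace h hinj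
  obtain ⟨n, a, g, hag⟩ := Submodule.mem_span_set'.1 (e.one_mem_span_env h hinj)
  choose r s hrs using fun i => (g i).2
  have h1 : ∑ i, (a i • r i) * e.env * s i = 1 := by
    simp_rw [← hag, hrs, smul_mul_assoc]
  set y : Fin n → A := fun i => AlgHom.mulLeftRight k A (a i • r i) 1 with hy
  set f : Fin n → Module.Dual k A := fun i => π ∘ₗ AlgHom.mulLeftRight k A (s i) with hf
  -- Since `e` acts as `z ↦ π z • 1`, each `(x ⊗ 1) * e * t` acts as a rank-one operator.
  have henv : ∀ x t, AlgHom.mulLeftRight k A ((x ⊗ₜ 1) * e.env * t) =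
      LinearMap.smulRight (π ∘ₗ AlgHom.mulLeftRight k A t) x := fun x t => by
    ext z
    simp [Module.End.mul_apply, mulLeftRight_env, ← hπ, Algebra.smul_def, Algebra.commutes]
  have hyr : ∀ i t, t * ((a i • r i) * e.env * s i) =
      (AlgHom.mulLeftRight k A t (y i) ⊗ₜ 1) * e.env * s i := fun i t => by
    rw [← mul_assoc, ← mul_assoc, e.mul_env (t * _), map_mul, Module.End.mul_apply]
  have hdual : ∀ x, ∑ i, f i x • y i = x := fun x => by
    have h2 : ∀ i, AlgHom.mulLeftRight k A ((a i • r i) * e.env * s i) x = f i x • y i :=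
      fun i => by
        have := hyr i 1
        rw [one_mul, map_one, Module.End.one_apply] at this
        rw [this, henv]
        rfl
    simp_rw [← h2, ← LinearMap.sum_apply, ← map_sum, h1, map_one, Module.End.one_apply]
  refine ⟨⟨(injective_iff_map_eq_zero _).2 fun t ht => ?_, fun φ => ?_⟩, n, y, f, hdual⟩
  -- Expanding `t = t * 1` by `hyr` shows that `t` is determined by its values on the `y i`. For
  -- surjectivity, the same expansion is written with `φ` in place of the action of `t`.
  · rw [← mul_one t, ← h1, Finset.mul_sum]
    exact Finset.sum_eq_zero fun i _ => by
      rw [hyr, ht, LinearMap.zero_apply, TensorProduct.zero_tmul, zero_mul, zero_mul]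
  · refine ⟨∑ i, (φ (y i) ⊗ₜ 1) * e.env * s i, LinearMap.ext fun x => ?_⟩
    conv_rhs => rw [← hdual x, map_sum]
    rw [map_sum, LinearMap.sum_apply]
    exact Finset.sum_congr rfl fun i _ => by rw [henv, map_smul]; rfl

/-- The inverse is `c ↦ c • (π ⊗ 1)`. If `r` acts as `z ↦ f z • 1`, then `π · r = f`, so `f ⊗ x = π
⊗ r x = f x • (π ⊗ 1)`. -/
theorem bijective_dualEvaluation {k A : Type u} [CommRing k] [Ring A] [Algebra k A]
    (hs : Function.Surjective (AlgHom.mulLeftRight k A)) (π : A →ₗ[k] k) (hπ : π 1 = 1) :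
    Function.Bijective (BimodCell.Hom.lin (dualEvaluation k A)) := by
  have hev : ∀ (f : A →ₗ[k] k) (x : A), BimodCell.Hom.lin (dualEvaluation k A)
      (BimodCell.tmk (dualAsBimod k A) (algebraAsBimod k A) f x) = f x := fun f x =>
    BimodCell.homOfBalanced_tmk (M := dualAsBimod k A) (N := algebraAsBimod k A)
      (P := BimodCell.unit (groundCell k)) (LinearMap.id (R := k) (M := A →ₗ[k] k)) _ _ _ f x
  let g : k →ₗ[k] BimodCell.TensorCarrier (dualAsBimod k A) (algebraAsBimod k A) :=
    LinearMap.toSpanSingleton k _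
      (BimodCell.tmk (dualAsBimod k A) (algebraAsBimod k A) π (1 : A))
  have h1 : g ∘ₗ BimodCell.Hom.lin (dualEvaluation k A) = LinearMap.id := by
    refine BimodCell.tensor_linext fun (f : A →ₗ[k] k) (x : A) => ?_
    rw [LinearMap.comp_apply, hev]
    obtain ⟨r, hr⟩ := hs (LinearMap.smulRight f 1)
    have hf : (dualAsBimod k A).ract (.op r) π = f := LinearMap.ext fun z => by
      change π (AlgHom.mulLeftRight k A r z) = f z
      simp [hr, hπ]
    have := BimodCell.tmk_balanced (dualAsBimod k A) (algebraAsBimod k A) π r x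
    rw [hf] at this
    refine Eq.trans ?_ this.symm
    change _ = BimodCell.tmk (dualAsBimod k A) (algebraAsBimod k A) π
      (AlgHom.mulLeftRight k A r x)
    rw [hr, LinearMap.smulRight_apply]
    exact (map_smul (BimodCell.tmk (dualAsBimod k A) (algebraAsBimod k A) π) (f x) (1 : A)).symm
  refine Function.bijective_iff_has_inverse.2 ⟨g, LinearMap.congr_fun h1, fun c => ?_⟩
  change BimodCell.Hom.lin (dualEvaluation k A) (c • _) = c
  rw [map_smul, hev, hπ]
  exact mul_one c

theorem IsSeparableAlgebra.isFaithfullyProjective_and_isSandwiched {k A : Type u} [CommRing k]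
    [Ring A] [Algebra k A] (hc : IsCentralAlgebra k A) (hs : IsSeparableAlgebra k A) :
    IsFaithfullyProjective k A ∧ IsSandwiched k A := by
  obtain ⟨e⟩ := hs.exists_separabilityElement
  obtain ⟨h, hinj⟩ := isCentralAlgebra_iff.1 hc
  obtain ⟨hsand, n, y, f, hyf⟩ := e.isSandwiched_and_exists_dualBasis h hinj
  obtain ⟨π, hπ, -⟩ := e.exists_trace h hinj
  exact ⟨⟨bijective_dualTensorHom_of_dualBasis y f hyf,
    bijective_dualEvaluation hsand.2 π hπ⟩, hsand⟩

/-! ### Algebras Eilenberg–Watts equivalent to the ground ring -/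

section

open CategoryTheory BimodCell
open scoped Bicategory

theorem BimodCell.exists_sum_tmk {k : Type u} [CommRing k] {A B C : AlgCell k}
    (M : BimodCell A B) (N : BimodCell B C) (x : TensorCarrier M N) :
    ∃ (n : ℕ) (f : Fin n → M.carrier) (g : Fin n → N.carrier), x = ∑ i, tmk M N (f i) (g i) := by
  obtain ⟨x, rfl⟩ := Submodule.Quotient.mk_surjective _ x
  obtain ⟨n, f, g, rfl⟩ := TensorProduct.exists_fin_sum x
  exact ⟨n, f, g, map_sum (balancedRel M N).mkQ _ _⟩

theorem BimodCell.bijective_lin {k : Type u} [CommRing k] {A B : AlgCell k}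
    {M N : BimodCell A B} (f : M ⟶ N) [IsIso f] : Function.Bijective (Hom.lin f) :=
  Function.bijective_iff_has_inverse.2 ⟨Hom.lin (inv f),
    LinearMap.congr_fun (congrArg Hom.lin (IsIso.hom_inv_id f)),
    LinearMap.congr_fun (congrArg Hom.lin (IsIso.inv_hom_id f))⟩

theorem BimodCell.ract_ground {k : Type u} [CommRing k] {A : AlgCell k}
    (X : BimodCell A (groundCell k)) (c : k) (x : X.carrier) :
    X.ract (.op c) x = c • x := by
  have h : (MulOpposite.op c : kᵐᵒᵖ) = algebraMap k kᵐᵒᵖ c := rfl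
  exact (LinearMap.congr_fun (congrArg X.ract h) x).trans
    (LinearMap.congr_fun (X.ract.commutes c) x)

/-- The triangle identity without inverse unitors, so that it can be evaluated on pure tensors. -/
theorem Bicategory.Adjunction.left_triangle_comp_rightUnitor {𝓑 : Type*} [Bicategory 𝓑] {a b : 𝓑} {f : a ⟶ b}
    {g : b ⟶ a} (p : Bicategory.Adjunction f g) :
    p.unit ▷ f ≫ (α_ f g f).hom ≫ f ◁ p.counit ≫ (ρ_ f).hom = (λ_ f).hom := by
  have := p.left_triangle
  rw [Bicategory.leftZigzag, ← cancel_mono (ρ_ f).hom] at this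
  simpa [bicategoricalComp] using this

theorem BimodCell.lact_ground {k : Type u} [CommRing k] {A : AlgCell k}
    (X : BimodCell (groundCell k) A) (c : k) (x : X.carrier) : X.lact c x = c • x :=
  LinearMap.congr_fun (X.lact.commutes c) x

/-- The data extracted from an invertible bimodule over `C` and the ground ring. -/
theorem IsInvertibleCell.exists_dualBasis {k : Type u} [CommRing k] {C : AlgCell k}
    {X : BimodCell C (groundCell k)}
    (hX : IsInvertibleCell (𝓑 := AlgCell k) (a := C) (b := groundCell k) X) :
    Function.Bijective X.lact ∧
    (∃ (n : ℕ) (x : Fin n → X.carrier) (f : Fin n → Module.Dual k X.carrier),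
      ∀ z, ∑ i, f i z • x i = z) ∧
    ∃ (m : ℕ) (q : Fin m → X.carrier) (g : Fin m → Module.Dual k X.carrier),
      ∑ i, g i (q i) = 1 := by
  obtain ⟨Y, p, hu, hc⟩ := hX
  change BimodCell (groundCell k) C at Y
  let coev : BimodCell.unit C ⟶ tensor X Y := p.unit
  let ev : tensor Y X ⟶ BimodCell.unit (groundCell k) := p.counit
  have hcoev : Function.Bijective (Hom.lin coev) := @bijective_lin _ _ _ _ _ _ coev hu
  have hev : Function.Bijective (Hom.lin ev) := @bijective_lin _ _ _ _ _ _ ev hc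
  let β : Y.carrier →ₗ[k] Module.Dual k X.carrier := (tmk Y X).compr₂ (Hom.lin ev)
  obtain ⟨n, x, y, hxy⟩ := exists_sum_tmk X Y (Hom.lin coev (1 : C.carrier))
  have hcoevc : ∀ c : C.carrier, Hom.lin coev c = ∑ i, tmk X Y (X.lact c (x i)) (y i) := fun c => by
    have h1 := Hom.map_lact coev c (1 : C.carrier)
    have h2 : (BimodCell.unit C).lact c (1 : C.carrier) = c := mul_one c
    rw [h2, hxy, map_sum] at h1
    simpa using h1
  -- The left triangle identity at `1 ⊗ z`, with `coev 1 = ∑ x i ⊗ y i`, is the dual basis formula.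
  have hdual : ∀ z, ∑ i, β (y i) z • x i = z := fun z => by
    have h0 : tensorHom coev (𝟙 X) ≫ (associatorIso X Y X).hom ≫ tensorHom (𝟙 X) ev ≫
        (rightUnitorIso X).hom = (leftUnitorIso X).hom := Bicategory.Adjunction.left_triangle_comp_rightUnitor p
    have h := LinearMap.congr_fun (congrArg Hom.lin h0)
      (tmk (BimodCell.unit C) X (1 : C.carrier) z)
    rw [leftUnitorIso_hom_tmk, map_one X.lact, Module.End.one_apply, comp_lin, comp_lin, comp_lin,
      LinearMap.comp_apply, LinearMap.comp_apply, LinearMap.comp_apply, tensorHom_tmk, hxy,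
      map_sum, LinearMap.sum_apply, map_sum, map_sum, map_sum] at h
    refine Eq.trans (Finset.sum_congr rfl fun i _ => ?_) h
    rw [id_lin, LinearMap.id_apply, associatorIso_hom_tmk, tensorHom_tmk, rightUnitorIso_hom_tmk,
      ract_ground]
    rfl
  refine ⟨⟨(injective_iff_map_eq_zero _).2 fun c hc0 => hcoev.1 ?_, fun φ => ?_⟩,
    ⟨n, x, fun i => β (y i), hdual⟩, ?_⟩
  · rw [map_zero]
    refine (hcoevc c).trans (Finset.sum_eq_zero fun i _ => ?_)
    rw [hc0, LinearMap.zero_apply, map_zero, LinearMap.zero_apply]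
  -- The candidate `c` has `coev c = ∑ φ (x i) ⊗ y i`. Contracting with `z` through `γ` turns this
  -- into `c z = φ z`.
  · obtain ⟨c, hcφ⟩ := hcoev.2 (∑ i, tmk X Y (φ (x i)) (y i))
    refine ⟨c, LinearMap.ext fun z => ?_⟩
    let γ : TensorCarrier X Y →ₗ[k] X.carrier :=
      tlift (M := X) (N := Y) (LinearMap.mk₂ k (fun w v => β v z • w)
        (fun _ _ _ => smul_add _ _ _) (fun _ _ _ => smul_comm _ _ _)
        (fun _ _ _ => by simp [add_smul]) (fun _ _ _ => by simp [mul_smul]))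
        (fun w b v => by
          rw [lact_ground, ract_ground]
          simp [smul_comm b])
    have h := congrArg γ ((hcoevc c).symm.trans hcφ)
    simp only [map_sum, γ, tlift_tmk, LinearMap.mk₂_apply] at h
    conv_lhs => rw [← hdual z]
    conv_rhs => rw [← hdual z]
    simpa using h
  · obtain ⟨w, hw⟩ := hev.2 (1 : k)
    obtain ⟨m, g, q, rfl⟩ := exists_sum_tmk Y X w
    refine ⟨m, q, fun i => β (g i), ?_⟩
    rw [← hw, map_sum]
    rfl

end

/-! ### Endomorphism algebras of modules with a dual basis and trace ideal `k` -/

section DualBasis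

variable {k M : Type*} [CommRing k] [AddCommGroup M] [Module k M]

/-- The separability element of the endomorphism algebra of a module with a dual basis and a
trace ideal that contains `1`. -/
def SeparabilityElement.endOfDualBasis {n m : ℕ} (x : Fin n → M) (f : Fin n → Module.Dual k M)
    (h : ∀ z, ∑ i, f i z • x i = z) (q : Fin m → M) (g : Fin m → Module.Dual k M)
    (hg : ∑ i, g i (q i) = 1) : SeparabilityElement k (Module.End k M) where
  ι := Fin n × Fin m
  -- For a free module, with `q` one basis vector and `g` its coordinate, this is the usual `∑
  -- E_{i1} ⊗ E_{1i}`.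
  c i := (g i.2).smulRight (x i.1)
  d i := (f i.1).smulRight (q i.2)
  sum_mul := LinearMap.ext fun z => by
    simp only [Fintype.sum_prod_type, LinearMap.sum_apply, Module.End.mul_apply,
      LinearMap.smulRight_apply, map_smul, Module.End.one_apply]
    simp_rw [← Finset.smul_sum, ← Finset.sum_smul, hg, one_smul, h]
  balanced φ := by
    -- Both `h1` and `h2` expand in the matrix entries `f l (φ (x i))`; these scalars cross the
    -- tensor sign.
    have h1 : ∀ i j, φ * (g j).smulRight (x i) =
        ∑ l, f l (φ (x i)) • (g j).smulRight (x l) := fun i j => LinearMap.ext fun z => by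
      simp only [Module.End.mul_apply, LinearMap.smulRight_apply, map_smul, LinearMap.sum_apply,
        LinearMap.smul_apply]
      simp_rw [smul_comm _ (g j z), ← Finset.smul_sum, h]
    have h2 : ∀ l j, (f l).smulRight (q j) * φ =
        ∑ i, f l (φ (x i)) • (f i).smulRight (q j) := fun l j => LinearMap.ext fun z => by
      simp only [Module.End.mul_apply, LinearMap.smulRight_apply, LinearMap.sum_apply,
        LinearMap.smul_apply, smul_smul, ← Finset.sum_smul]
      conv_lhs => rw [← h z]
      simp [mul_comm]
    simp_rw [Fintype.sum_prod_type, h1, h2, TensorProduct.sum_tmul, TensorProduct.tmul_sum,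
      TensorProduct.smul_tmul]
    rw [Finset.sum_comm]
    conv_rhs => rw [Finset.sum_comm]
    exact Finset.sum_congr rfl fun j _ => Finset.sum_comm

/-- Commuting `z` with the rank-one map `g i (·) • w`, evaluating at `q i` and summing gives `z w`
as a scalar multiple of `w`, with scalar independent of `w`. -/
theorem centralScalars_end {m : ℕ} (q : Fin m → M) (g : Fin m → Module.Dual k M)
    (hg : ∑ i, g i (q i) = 1) : CentralScalars k (Module.End k M) := fun z hz => by
  refine ⟨∑ i, g i (z (q i)), LinearMap.ext fun w => ?_⟩
  have : ∀ i, g i (z (q i)) • w = g i (q i) • z w := fun i => by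
    simpa using LinearMap.congr_fun (hz ((g i).smulRight w)) (q i)
  rw [Module.algebraMap_end_apply, Finset.sum_smul]
  simp_rw [this, ← Finset.sum_smul, hg, one_smul]

theorem injective_algebraMap_end {m : ℕ} (q : Fin m → M) (g : Fin m → Module.Dual k M)
    (hg : ∑ i, g i (q i) = 1) : Function.Injective (algebraMap k (Module.End k M)) :=
  (injective_iff_map_eq_zero _).2 fun c hc => by
    have : ∀ i, c * g i (q i) = 0 := fun i => by
      rw [← smul_eq_mul, ← map_smul, ← Module.algebraMap_end_apply (S := k), hc]
      simp
    rw [← mul_one c, ← hg, Finset.mul_sum]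
    exact Finset.sum_eq_zero fun i _ => this i

end DualBasis

/-! ### Descent of central separability to a tensor factor -/

section Factor

variable {k A B : Type*} [CommRing k] [Ring A] [Algebra k A] [Ring B] [Algebra k B]

/-- A tensor factor of a central separable algebra is central and separable. -/
theorem exists_separabilityElement_of_tensor (e : SeparabilityElement k (A ⊗[k] B))
    (h : CentralScalars k (A ⊗[k] B)) (hinj : Function.Injective (algebraMap k (A ⊗[k] B))) :
    Nonempty (SeparabilityElement k A) ∧ CentralScalars k A ∧
      Function.Injective (algebraMap k A) := by
  obtain ⟨π, hπ1, -⟩ := e.exists_trace h hinj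
  -- The slice `ρ = id ⊗ t` retracts `A ⊗ B` onto `A`. Its analogue `μ` multiplies the two `B`
  -- factors before applying `t`.
  let t : B →ₗ[k] k := π ∘ₗ TensorProduct.mk k A B 1
  have ht : t 1 = 1 := hπ1
  let ρ : A ⊗[k] B →ₗ[k] A := TensorProduct.rid k A ∘ₗ LinearMap.lTensor A t
  have hρ : ∀ a b, ρ (a ⊗ₜ b) = t b • a := fun a b => by simp [ρ]
  let μ : (A ⊗[k] B) ⊗[k] (A ⊗[k] B) →ₗ[k] A ⊗[k] A :=
    TensorProduct.rid k (A ⊗[k] A) ∘ₗ LinearMap.lTensor (A ⊗[k] A) (t ∘ₗ LinearMap.mul' k B) ∘ₗ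
      (TensorProduct.tensorTensorTensorComm k A B A B).toLinearMap
  have hμ : ∀ a b a' b', μ ((a ⊗ₜ b) ⊗ₜ (a' ⊗ₜ b')) = t (b * b') • a ⊗ₜ[k] a' :=
    fun a b a' b' => by simp [μ]
  have hmul : ∀ u v, LinearMap.mul' k A (μ (u ⊗ₜ v)) = ρ (u * v) := fun u v => by
    induction u with
    | zero => simp
    | add x y hx hy => simp only [TensorProduct.add_tmul, map_add, hx, hy, add_mul]
    | tmul a b =>
      induction v with
      | zero => simp
      | add x y hx hy => simp only [TensorProduct.tmul_add, map_add, hx, hy, mul_add]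
      | tmul a' b' => simp [hμ, hρ]
  have hleft : ∀ z u v, μ (((z ⊗ₜ 1) * u) ⊗ₜ v) =
      LinearMap.rTensor A (LinearMap.mulLeft k z) (μ (u ⊗ₜ v)) := fun z u v => by
    induction u with
    | zero => simp
    | add x y hx hy => simp only [TensorProduct.add_tmul, map_add, hx, hy, mul_add]
    | tmul a b =>
      induction v with
      | zero => simp
      | add x y hx hy => simp only [TensorProduct.tmul_add, map_add, hx, hy]
      | tmul a' b' => simp [hμ]
  have hright : ∀ z u v, μ (u ⊗ₜ (v * (z ⊗ₜ 1))) =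
      LinearMap.lTensor A (LinearMap.mulRight k z) (μ (u ⊗ₜ v)) := fun z u v => by
    induction u with
    | zero => simp
    | add x y hx hy => simp only [TensorProduct.add_tmul, map_add, hx, hy]
    | tmul a b =>
      induction v with
      | zero => simp
      | add x y hx hy => simp only [TensorProduct.tmul_add, map_add, hx, hy, add_mul]
      | tmul a' b' => simp [hμ]
  refine ⟨?_, fun z hz => ?_, fun c c' hcc => hinj ?_⟩
  -- The new separability element is the image under `μ` of the old one: `hmul` gives product `ρ 1 =
  -- 1`, and `hleft`, `hright` carry balancedness over.
  · obtain ⟨n, c, d, hcd⟩ := TensorProduct.exists_fin_sum (μ (∑ i, e.c i ⊗ₜ e.d i))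
    refine ⟨⟨Fin n, c, d, ?_, fun a => ?_⟩⟩
    · have h1 := congrArg (LinearMap.mul' k A) hcd
      simp only [map_sum, hmul] at h1
      rw [← map_sum, e.sum_mul, Algebra.TensorProduct.one_def, hρ, ht, one_smul] at h1
      simpa using h1.symm
    · have h1 := congrArg μ (e.balanced (a ⊗ₜ 1))
      simp only [map_sum, hleft, hright] at h1
      simp only [← map_sum] at h1
      rw [hcd] at h1
      simpa using h1
  -- For `z` central in `A`, `z ⊗ 1` is central, hence a scalar, and `ρ` recovers `z` from it.
  · obtain ⟨c, hc⟩ := h (z ⊗ₜ 1) fun w => by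
      induction w with
      | zero => simp
      | add x y hx hy => rw [add_mul, mul_add, hx, hy]
      | tmul a b => simp [hz]
    refine ⟨c, ?_⟩
    have := congrArg ρ hc
    rwa [Algebra.TensorProduct.algebraMap_apply, hρ, hρ, ht, one_smul, one_smul] at this
  · rw [Algebra.TensorProduct.algebraMap_apply, hcc, Algebra.TensorProduct.algebraMap_apply]

end Factor

theorem isCentralAlgebra_and_isSeparableAlgebra_of_equivalent {k : Type u} [CommRing k]
    {A B : Type u} [Ring A] [Algebra k A] [Ring B] [Algebra k B]
    (h : EilenbergWattsEquivalent (AlgCell.of k (A ⊗[k] B)) (AlgCell.of k k)) :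
    IsCentralAlgebra k A ∧ IsSeparableAlgebra k A := by
  obtain ⟨X, hX⟩ := h
  change BimodCell (AlgCell.of k (A ⊗[k] B)) (groundCell k) at X
  obtain ⟨hbij, ⟨n, x, f, hxf⟩, m, q, g, hqg⟩ := IsInvertibleCell.exists_dualBasis hX
  let Φ : A ⊗[k] B ≃ₐ[k] Module.End k X.carrier := AlgEquiv.ofBijective X.lact hbij
  obtain ⟨⟨e⟩, hc, hi⟩ := exists_separabilityElement_of_tensor (A := A) (B := B)
    ((SeparabilityElement.endOfDualBasis x f hxf q g hqg).map Φ.symm.toAlgHom Φ.symm.surjective)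
    (fun z hz => by
      obtain ⟨c, hc⟩ := centralScalars_end q g hqg (Φ z) fun w => by
        obtain ⟨w, rfl⟩ := Φ.surjective w
        rw [← map_mul, hz, map_mul]
      exact ⟨c, Φ.injective (by rw [← hc, AlgEquiv.commutes])⟩)
    (fun c c' hcc => injective_algebraMap_end q g hqg (by
      rw [← Φ.commutes, hcc, Φ.commutes]))
  exact ⟨isCentralAlgebra_iff.2 ⟨hc, hi⟩, e.isSeparableAlgebra⟩

/-! ### Invertibility of a faithfully projective algebra -/

section

open CategoryTheory BimodCell
open scoped Bicategory

theorem BimodCell.isIso_of_bijective {k : Type u} [CommRing k] {A B : AlgCell k}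
    {M N : BimodCell A B} (f : M ⟶ N) (hf : Function.Bijective (Hom.lin f)) : IsIso f :=
  let g := LinearEquiv.ofBijective (Hom.lin f) hf
  (isoOfInverse f g.symm.toLinearMap (LinearMap.ext g.symm_apply_apply)
    (LinearMap.ext g.apply_symm_apply)).isIso_hom

/-- For invertible unit and counit, either triangle identity implies the other, so only one needs
checking. -/
theorem Bicategory.exists_adjunction_of_left_triangle {𝓑 : Type*} [Bicategory 𝓑] {a b : 𝓑}
    {f : a ⟶ b} {g : b ⟶ a} (coev : 𝟙 a ⟶ f ≫ g) (ev : g ≫ f ⟶ 𝟙 b) [IsIso coev] [IsIso ev]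
    (h : coev ▷ f ≫ (α_ f g f).hom ≫ f ◁ ev ≫ (ρ_ f).hom = (λ_ f).hom) :
    ∃ p : Bicategory.Adjunction f g, IsIso p.unit ∧ IsIso p.counit := by
  have hl : Bicategory.leftZigzag (asIso coev).hom (asIso ev).hom = (λ_ f).hom ≫ (ρ_ f).inv := by
    rw [Bicategory.leftZigzag, ← cancel_mono (ρ_ f).hom]
    simpa [bicategoricalComp] using h
  exact ⟨⟨coev, ev, hl, Bicategory.right_triangle_of_left_triangle (asIso coev) (asIso ev) hl⟩, ‹_›, ‹_›⟩

/-- A bimodule `X` over `C` and the ground ring is invertible if `C` acts on it as its algebra of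
endomorphisms, it has a dual basis in `Y ⊆ Hom_k(X, k)`, and the evaluation is an isomorphism. -/
theorem isInvertibleCell_of_dualBasis {k : Type u} [CommRing k] {C : AlgCell k}
    {X : BimodCell C (groundCell k)} {Y : BimodCell (groundCell k) C}
    (ev : tensor Y X ⟶ BimodCell.unit (groundCell k)) (hev : Function.Bijective (Hom.lin ev))
    (β : Y.carrier →ₗ[k] Module.Dual k X.carrier) (hβ : Function.Injective β)
    (hβev : ∀ y z, Hom.lin ev (tmk Y X y z) = β y z) (hX : Function.Bijective X.lact)
    {n : ℕ} (x : Fin n → X.carrier) (y : Fin n → Y.carrier)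
    (hxy : ∀ z, ∑ i, β (y i) z • x i = z) :
    IsInvertibleCell (𝓑 := AlgCell k) (a := C) (b := groundCell k) X := by
  -- Injectivity of `β` transfers the dual expansion from functionals to `Y`.
  have hy : ∀ w, ∑ i, β w (x i) • y i = w := fun w => hβ <| LinearMap.ext fun z => by
    conv_rhs => rw [← hxy z, map_sum]
    simp [LinearMap.sum_apply, mul_comm]
  have hβr : ∀ c w z, β (Y.ract (.op c) w) z = β w (X.lact c z) := fun c w z => by
    rw [← hβev, tmk_balanced, hβev]
  let U : TensorCarrier X Y := ∑ i, tmk X Y (x i) (y i)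
  have hUl : ∀ c, (tensor X Y).lact c U = ∑ i, tmk X Y (X.lact c (x i)) (y i) := fun c =>
    (map_sum _ _ _).trans (Finset.sum_congr rfl fun i _ => tensor_lact_tmk X Y c (x i) (y i))
  -- The Casimir element `U` commutes with `C`: both sides expand to one double sum with
  -- coefficients `β (y l) (c x i)`. This makes `c ↦ c U` a bimodule map.
  have hUr : ∀ c, (tensor X Y).ract (.op c) U = (tensor X Y).lact c U := fun c => by
    have h1 : (tensor X Y).ract (.op c) U = ∑ l, tmk X Y (x l) (Y.ract (.op c) (y l)) :=
      (map_sum _ _ _).trans (Finset.sum_congr rfl fun i _ => tensor_ract_tmk X Y _ (x i) (y i))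
    have h2 : ∀ l, tmk X Y (x l) (Y.ract (.op c) (y l)) =
        ∑ i, β (y l) (X.lact c (x i)) • tmk X Y (x l) (y i) := fun l => by
      conv_lhs => rw [← hy (Y.ract (.op c) (y l))]
      simp only [map_sum, map_smul, hβr]
    have h3 : ∀ i, tmk X Y (X.lact c (x i)) (y i) =
        ∑ l, β (y l) (X.lact c (x i)) • tmk X Y (x l) (y i) := fun i => by
      conv_lhs => rw [← hxy (X.lact c (x i))]
      simp only [map_sum, map_smul, LinearMap.sum_apply, LinearMap.smul_apply]
    rw [h1, hUl]
    simp_rw [h2, h3]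
    exact Finset.sum_comm
  let coev : BimodCell.unit C ⟶ tensor X Y := Hom.mk (M := BimodCell.unit C)
    (LinearMap.flip (tensor X Y).lact.toLinearMap U)
    (fun r s => LinearMap.congr_fun (map_mul (tensor X Y).lact r s) U)
    (fun s r => by
      refine (LinearMap.congr_fun (map_mul (tensor X Y).lact r s.unop) U).trans ?_
      refine (congrArg ((tensor X Y).lact r) (hUr s.unop).symm).trans ?_
      exact (tensor X Y).comm r s U)
  have hcoev : ∀ c, Hom.lin coev c = ∑ i, tmk X Y (X.lact c (x i)) (y i) := hUl
  -- As `γ ∘ coev` is the action of `C`, which is bijective, `coev` is injective; its right inverse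
  -- is `γ` followed by the inverse of the action.
  let γ : TensorCarrier X Y →ₗ[k] Module.End k X.carrier :=
    tlift (M := X) (N := Y) ((LinearMap.smulRightₗ (R := k) (M := X.carrier)
        (M₂ := X.carrier)).flip.compl₂ β)
      (fun w b v => by
        rw [lact_ground, ract_ground]
        exact LinearMap.ext fun z => by simp [smul_comm b])
  have hγ : ∀ w v, γ (tmk X Y w v) = LinearMap.smulRight (β v) w := fun w v => tlift_tmk _ _ w v
  have hγc : ∀ c, γ (Hom.lin coev c) = X.lact c := fun c => LinearMap.ext fun z => by
    rw [hcoev, map_sum, LinearMap.sum_apply]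
    conv_rhs => rw [← hxy z, map_sum]
    refine Finset.sum_congr rfl fun i _ => ?_
    rw [hγ, LinearMap.smulRight_apply, map_smul]
  have hbij : Function.Bijective (Hom.lin coev) := by
    refine ⟨fun c c' h => hX.1 ?_, ?_⟩
    · rw [← hγc, h, hγc]
    · let σ := LinearEquiv.ofBijective X.lact.toLinearMap hX
      have h1 : Hom.lin coev ∘ₗ σ.symm.toLinearMap ∘ₗ γ = LinearMap.id := by
        refine tensor_linext fun w v => ?_
        have h2 : X.lact (σ.symm (γ (tmk X Y w v))) = LinearMap.smulRight (β v) w :=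
          (σ.apply_symm_apply _).trans (hγ w v)
        refine (hcoev (σ.symm (γ (tmk X Y w v)))).trans ?_
        rw [h2]
        simp_rw [LinearMap.smulRight_apply, map_smul, LinearMap.smul_apply]
        conv_rhs => rw [← hy v]
        simp only [map_sum, map_smul, LinearMap.id_apply]
      exact fun w => ⟨_, LinearMap.congr_fun h1 w⟩
  have hcoevIso : IsIso (C := BimodCell C C) coev := isIso_of_bijective coev hbij
  have hevIso : IsIso (C := BimodCell (groundCell k) (groundCell k)) ev :=
    isIso_of_bijective ev hev
  refine ⟨Y, Bicategory.exists_adjunction_of_left_triangle (𝓑 := AlgCell k) (f := X) (g := Y)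
    coev ev ?_⟩
  change tensorHom coev (𝟙 X) ≫ (associatorIso X Y X).hom ≫ tensorHom (𝟙 X) ev ≫
    (rightUnitorIso X).hom = (leftUnitorIso X).hom
  -- At `c ⊗ z`, the triangle reads `∑ β (y i) z • c (x i) = c z`, the dual basis formula after
  -- acting by `c`.
  refine tensor_homext (M := BimodCell.unit C) fun c z => ?_
  rw [leftUnitorIso_hom_tmk, comp_lin, comp_lin, comp_lin, LinearMap.comp_apply,
    LinearMap.comp_apply, LinearMap.comp_apply, tensorHom_tmk, hcoev, map_sum,
    LinearMap.sum_apply, map_sum, map_sum, map_sum]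
  conv_rhs => rw [← hxy z, map_sum]
  refine Finset.sum_congr rfl fun i _ => ?_
  rw [id_lin, LinearMap.id_apply, associatorIso_hom_tmk, tensorHom_tmk, rightUnitorIso_hom_tmk,
    hβev, ract_ground, map_smul]
  rfl

theorem isInvertibleCell_algebraAsBimod {k : Type u} [CommRing k] {A : Type u} [Ring A]
    [Algebra k A] (hp : IsFaithfullyProjective k A) (hs : IsSandwiched k A) :
    IsInvertibleCell (algebraAsBimod k A) := by
  obtain ⟨n, x, f, hxf⟩ := exists_dualBasis_of_surjective hp.1.2
  exact isInvertibleCell_of_dualBasis (X := algebraAsBimod k A) (Y := dualAsBimod k A)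
    (dualEvaluation k A) hp.2 (LinearMap.id (R := k) (M := A →ₗ[k] k)) (fun _ _ h => h)
    (fun g z => homOfBalanced_tmk (M := dualAsBimod k A) (N := algebraAsBimod k A)
      (P := BimodCell.unit (groundCell k)) (LinearMap.id (R := k) (M := A →ₗ[k] k)) _ _ _ g z)
    hs x f hxf

end

theorem mainTheorem5 (k : Type u) [CommRing k] (A : Type u) [Ring A] [Algebra k A] :
    List.TFAE [
      IsInvertibleCell (algebraAsBimod k A),
      IsCentralAlgebra k A ∧ IsSeparableAlgebra k A,
      IsFaithfullyProjective k A ∧ IsSandwiched k A,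
      ∃ (B : Type u) (_ : Ring B) (_ : Algebra k B),
        EilenbergWattsEquivalent (AlgCell.of k (A ⊗[k] B)) (AlgCell.of k k)] ∧
    (IsInvertibleCell (algebraAsBimod k A) →
      EilenbergWattsEquivalent (AlgCell.of k (A ⊗[k] Aᵐᵒᵖ)) (AlgCell.of k k)) := by
  refine ⟨?_, fun h => ⟨_, h⟩⟩
  tfae_have 1 → 4 := fun h => ⟨Aᵐᵒᵖ, inferInstance, inferInstance, _, h⟩
  tfae_have 4 → 2 := fun ⟨_, _, _, h⟩ =>
    isCentralAlgebra_and_isSeparableAlgebra_of_equivalent h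
  tfae_have 2 → 3 := fun h =>
    IsSeparableAlgebra.isFaithfullyProjective_and_isSandwiched h.1 h.2
  tfae_have 3 → 1 := fun h => isInvertibleCell_algebraAsBimod h.1 h.2
  tfae_finish
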